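/- An independent cut of a graph $G$ is an independent set $S \subseteq V(G)$ such that $G-S$ is disconnected, and \textsc{Independent Cut} (IC) is the problem of deciding whether a given finite simple undirected graph has an independent cut. There are an algorithm (a program for a random access machine with unit-cost addition and subtraction, which receives the order of the graph and its adjacency matrix as input) and a constant $c$ such that the following holds: for every real number $\beta > \frac12$ and every graph $G$ of order $n \geq 1$ and minimum degree at least $\beta n$, the algorithm decides in at most $2^{1/(2\beta-1)^2}\, n^{c}$ steps whether $G$ has an independent cut. In particular, IC on such graphs is fixed-parameter tractable when parameterized by $\beta$: there are an algorithm, a constant $c$ and a function $f$ with natural values on the real numbers, computable at nonnegative rational arguments, such that the algorithm decides IC within $f(\beta)\, n^{c}$ steps for every real $\beta > \frac12$ and every graph of order $n \geq 1$ and minimum degree at least $\beta n$. -/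

import Mathlib

/-! ### The problem -/

/-- `G` has an independent cut: an independent set `S` of vertices such that `G - S` is
disconnected, i.e. has two vertices that no path of `G - S` joins. -/
def HasIndependentCut {V : Type*} (G : SimpleGraph V) : Prop :=
  ∃ S : Set V, G.IsIndepSet S ∧ ¬ (G.induce Sᶜ).Preconnected

open Classical in
/-- `G` is a nonempty graph of order `n` with minimum degree at least `β * n`, and `β > 1/2`. -/
def IsDense {n : ℕ} (G : SimpleGraph (Fin n)) (β : ℝ) : Prop :=
  0 < n ∧ 1 / 2 < β ∧ β * (n : ℝ) ≤ (G.minDegree : ℝ)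

/-! ### Random access machines with a step count -/

namespace RAM

/-- Programs of a random access machine with registers `0, 1, 2, …`, each holding a natural number
(a program mentions only finitely many of them), and with a memory of cells `0, 1, 2, …`, each
holding a natural number, that is accessed indirectly. -/
inductive Prog : Type
  /-- `reg r := k` for a literal `k` -/
  | const (r k : ℕ)
  /-- `reg r := reg a` -/
  | move (r a : ℕ)
  /-- `reg r := reg a + reg b` -/
  | add (r a b : ℕ)
  /-- `reg r := max (reg a - reg b) 0` -/
  | sub (r a b : ℕ)
  /-- `reg r := mem[reg a]` -/
  | load (r a : ℕ)
  /-- `mem[reg a] := reg r` -/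
  | store (a r : ℕ)
  /-- run `p`, then `q` -/
  | seq (p q : Prog)
  /-- if `reg r ≠ 0` run `p`, otherwise run `q` -/
  | cond (r : ℕ) (p q : Prog)
  /-- while `reg r ≠ 0`, run `p` -/
  | loop (r : ℕ) (p : Prog)

/-- The contents of the registers and of the memory. -/
@[ext]
structure Store : Type where
  reg : ℕ → ℕ
  mem : ℕ → ℕ

/-- Write `v` into register `r`. -/
def Store.setReg (s : Store) (r v : ℕ) : Store :=
  { s with reg := Function.update s.reg r v }

/-- Write `v` into memory cell `a`. -/
def Store.setMem (s : Store) (a v : ℕ) : Store :=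
  { s with mem := Function.update s.mem a v }

/-- `Exec p s s' t`: started on `s`, the program `p` halts on `s'` after exactly `t` steps. Every
elementary instruction and every test of a register takes one step. -/
inductive Exec : Prog → Store → Store → ℕ → Prop
  | const (s : Store) (r k : ℕ) : Exec (.const r k) s (s.setReg r k) 1
  | move (s : Store) (r a : ℕ) : Exec (.move r a) s (s.setReg r (s.reg a)) 1
  | add (s : Store) (r a b : ℕ) : Exec (.add r a b) s (s.setReg r (s.reg a + s.reg b)) 1
  | sub (s : Store) (r a b : ℕ) : Exec (.sub r a b) s (s.setReg r (s.reg a - s.reg b)) 1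
  | load (s : Store) (r a : ℕ) : Exec (.load r a) s (s.setReg r (s.mem (s.reg a))) 1
  | store (s : Store) (a r : ℕ) : Exec (.store a r) s (s.setMem (s.reg a) (s.reg r)) 1
  | seq {p q : Prog} {s₁ s₂ s₃ : Store} {t u : ℕ} :
      Exec p s₁ s₂ t → Exec q s₂ s₃ u → Exec (.seq p q) s₁ s₃ (t + u)
  | cond_true {r : ℕ} {p q : Prog} {s s' : Store} {t : ℕ} :
      s.reg r ≠ 0 → Exec p s s' t → Exec (.cond r p q) s s' (t + 1)
  | cond_false {r : ℕ} {p q : Prog} {s s' : Store} {t : ℕ} :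
      s.reg r = 0 → Exec q s s' t → Exec (.cond r p q) s s' (t + 1)
  | loop_done {r : ℕ} {p : Prog} {s : Store} :
      s.reg r = 0 → Exec (.loop r p) s s 1
  | loop_step {r : ℕ} {p : Prog} {s₁ s₂ s₃ : Store} {t u : ℕ} :
      s₁.reg r ≠ 0 → Exec p s₁ s₂ t → Exec (.loop r p) s₂ s₃ u →
        Exec (.loop r p) s₁ s₃ (t + u + 1)

/-- Programs are deterministic: the final store and the number of steps are unique. -/
theorem Exec.unique {p : Prog} {s s₁ : Store} {t₁ : ℕ} (h₁ : Exec p s s₁ t₁) :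
    ∀ {s₂ : Store} {t₂ : ℕ}, Exec p s s₂ t₂ → s₁ = s₂ ∧ t₁ = t₂ := by
  induction h₁ with
  | const | move | add | sub | load | store =>
    intro s₂ t₂ h
    cases h
    exact ⟨rfl, rfl⟩
  | seq _ _ ihp ihq =>
    intro s₂ t₂ h
    cases h with
    | seq hp hq =>
      obtain ⟨rfl, rfl⟩ := ihp hp
      obtain ⟨rfl, rfl⟩ := ihq hq
      exact ⟨rfl, rfl⟩
  | cond_true hr _ ih =>
    intro s₂ t₂ h
    cases h with
    | cond_true _ hp =>
      obtain ⟨rfl, rfl⟩ := ih hp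
      exact ⟨rfl, rfl⟩
    | cond_false hr' _ => exact absurd hr' hr
  | cond_false hr _ ih =>
    intro s₂ t₂ h
    cases h with
    | cond_true hr' _ => exact absurd hr hr'
    | cond_false _ hq =>
      obtain ⟨rfl, rfl⟩ := ih hq
      exact ⟨rfl, rfl⟩
  | loop_done hr =>
    intro s₂ t₂ h
    cases h with
    | loop_done _ => exact ⟨rfl, rfl⟩
    | loop_step hr' _ _ => exact absurd hr hr'
  | loop_step hr _ _ ihp ihq =>
    intro s₂ t₂ h
    cases h with
    | loop_done hr' => exact absurd hr' hr
    | loop_step _ hp hq =>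
      obtain ⟨rfl, rfl⟩ := ihp hp
      obtain ⟨rfl, rfl⟩ := ihq hq
      exact ⟨rfl, rfl⟩

open Classical in
/-- The input for a graph `G` on `0, …, n - 1`: register `0` holds `n`, the memory holds the
adjacency matrix row by row, and everything else is `0`. -/
noncomputable def input {n : ℕ} (G : SimpleGraph (Fin n)) : Store where
  reg r := if r = 0 then n else 0
  mem k := if ∃ i j : Fin n, k = (i : ℕ) * n + (j : ℕ) ∧ G.Adj i j then 1 else 0

open Classical in
/-- Given `G`, the program `P` halts after at most `T` steps, with `1` in register `0` if `Q`
holds and with `0` in register `0` otherwise. -/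
def DecidesWithin (P : Prog) {n : ℕ} (G : SimpleGraph (Fin n)) (Q : Prop) (T : ℝ) : Prop :=
  ∃ (s : Store) (t : ℕ), Exec P (input G) s t ∧ (t : ℝ) ≤ T ∧ s.reg 0 = if Q then 1 else 0

end RAM

/-- The graph problem `Q` is fixed-parameter tractable on the instances `(G, β)` in `D`, where the
real number `β` is the parameter: one algorithm decides `Q` on every such `G` in time
`f(β) * n ^ c`, for a constant `c` and a function `f` of the parameter alone that is computable,
meaning that `f(p / q)` can be computed from the natural numbers `p` and `q`. The algorithm is
given only `G`, not `β`. -/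
def IsFixedParameterTractable (Q : ∀ {n : ℕ}, SimpleGraph (Fin n) → Prop)
    (D : ∀ {n : ℕ}, SimpleGraph (Fin n) → ℝ → Prop) : Prop :=
  ∃ (P : RAM.Prog) (f : ℝ → ℕ) (c : ℕ),
    Computable (fun x : ℕ × ℕ => f ((x.1 : ℝ) / (x.2 : ℝ))) ∧
    ∀ (n : ℕ) (G : SimpleGraph (Fin n)) (β : ℝ), D G β →
      RAM.DecidesWithin P G (Q G) ((f β : ℝ) * (n : ℝ) ^ c)

/-! Label the vertices by 0 (the cut) and by 1 and 2 (two sides without edges between them). An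
independent cut amounts to such a labelling in which the labels of adjacent vertices sum to neither
0 nor 3 and both sides occur (`hasIndependentCut_iff`). Fixing the label of a vertex `d` leaves `d`
no other choice and takes one label away from each neighbour of `d`.

If all degrees are at least n/2, double counting shows that every set of vertices has at least half
of its members in the closed neighbourhood of a single vertex (`exists_chosen`). Hence, once about
log₂ n greedily chosen vertices are labelled, every vertex has lost a label (`exists_guess`). Their
labels are the ternary digits of one number, the guess, and fewer than 4n² guesses need to be tried.

What remains for one guess is 2-satisfiability, solved by resolution. Vertices are eliminated one at
a time; since one label of the vertex is impossible, an obstruction to the other two involves only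
two literals, so a binary clash relation records all consequences
(`exists_labelling_of_elimination`, `not_clash_of_elimination`). Acceptance is sound without any
degree condition (`Accepts.exists_isCutLabelling`); density is needed for completeness
(`IsCutLabelling.exists_accepts`).

The whole method is polynomial in n, uniformly in β. The factor 2^(1/(2β-1)²) is at least 1, and the
parameter function can be the constant 1. To run the method on the machine, a small language of
bounded sums and loops is compiled with a polynomial step bound (`RAM.Expr.runs_compile`,
`RAM.Cmd.runs_compile`, `RAM.exists_runs_program`), and the method is expressed and verified in that
language (`RAM.Cmd.run_search`). -/

namespace RAM

/-! ### Total correctness of programs with a time bound -/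

/-- Started on `s`, the program `p` halts within `T` steps on a store that satisfies `Q`. -/
def Runs (p : Prog) (s : Store) (T : ℕ) (Q : Store → Prop) : Prop :=
  ∃ (s' : Store) (t : ℕ), Exec p s s' t ∧ t ≤ T ∧ Q s'

namespace Runs

variable {p q : Prog} {s : Store} {T U : ℕ} {Q R : Store → Prop}

theorem mono (h : Runs p s T Q) (hT : T ≤ U) (hQ : ∀ s', Q s' → R s') : Runs p s U R := by
  obtain ⟨s', t, he, ht, hs⟩ := h
  exact ⟨s', t, he, ht.trans hT, hQ _ hs⟩

theorem const {r k : ℕ} (h : Q (s.setReg r k)) : Runs (.const r k) s 1 Q :=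
  ⟨_, _, .const s r k, le_rfl, h⟩

theorem move {r a : ℕ} (h : Q (s.setReg r (s.reg a))) : Runs (.move r a) s 1 Q :=
  ⟨_, _, .move s r a, le_rfl, h⟩

theorem add {r a b : ℕ} (h : Q (s.setReg r (s.reg a + s.reg b))) : Runs (.add r a b) s 1 Q :=
  ⟨_, _, .add s r a b, le_rfl, h⟩

theorem sub {r a b : ℕ} (h : Q (s.setReg r (s.reg a - s.reg b))) : Runs (.sub r a b) s 1 Q :=
  ⟨_, _, .sub s r a b, le_rfl, h⟩

theorem load {r a : ℕ} (h : Q (s.setReg r (s.mem (s.reg a)))) : Runs (.load r a) s 1 Q :=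
  ⟨_, _, .load s r a, le_rfl, h⟩

theorem store {a r : ℕ} (h : Q (s.setMem (s.reg a) (s.reg r))) : Runs (.store a r) s 1 Q :=
  ⟨_, _, .store s a r, le_rfl, h⟩

/-- The second run sits inside the postcondition of the first, so a program is verified by forward
symbolic execution. -/
theorem seq (h : Runs p s T fun s' => Runs q s' U Q) : Runs (.seq p q) s (T + U) Q := by
  obtain ⟨s', t, he, ht, s'', u, he', hu, hQ⟩ := h
  exact ⟨s'', t + u, .seq he he', add_le_add ht hu, hQ⟩

/-- The budgets of both branches are added instead of maximised: this is wasteful but keeps cost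
functions free of case distinctions. -/
theorem cond {r : ℕ} (h₁ : s.reg r ≠ 0 → Runs p s T Q) (h₂ : s.reg r = 0 → Runs q s U Q) :
    Runs (.cond r p q) s (T + U + 1) Q := by
  by_cases h : s.reg r = 0
  · obtain ⟨s', t, he, ht, hQ⟩ := h₂ h
    exact ⟨s', t + 1, .cond_false h he, by omega, hQ⟩
  · obtain ⟨s', t, he, ht, hQ⟩ := h₁ h
    exact ⟨s', t + 1, .cond_true h he, by omega, hQ⟩

/-- A loop whose control register counts down from `N`. -/
theorem loop {r N : ℕ} (I : ℕ → Store → Prop) (hr : ∀ i s, I i s → s.reg r = N - i)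
    (hstep : ∀ i < N, ∀ s, I i s → Runs p s T (I (i + 1))) (h : I 0 s) :
    Runs (.loop r p) s (N * (T + 1) + 1) (I N) := by
  -- Induction on the number `m` of remaining rounds, from an arbitrary intermediate state.
  have key : ∀ m i s, i + m = N → I i s → Runs (.loop r p) s (m * (T + 1) + 1) (I N) := by
    intro m
    induction m with
    | zero =>
      intro i s hi hI
      obtain rfl : i = N := by omega
      exact ⟨s, 1, .loop_done (by rw [hr _ _ hI]; omega), by omega, hI⟩
    | succ m ih =>
      intro i s hi hI
      obtain ⟨s', t, he, ht, hI'⟩ := hstep i (by omega) s hI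
      obtain ⟨s'', u, he', hu, hI''⟩ := ih (i + 1) s' (by omega) hI'
      refine ⟨s'', t + u + 1, .loop_step (by rw [hr _ _ hI]; omega) he he', ?_, hI''⟩
      rw [Nat.succ_mul]
      omega
  exact key N 0 s (by omega) h

end Runs

/-! ### A language of bounded loops -/

/-- Expressions over variables `0, 1, 2, …` and a three-dimensional array. -/
inductive Expr : Type
  | lit (c : ℕ)
  | var (i : ℕ)
  | add (a b : Expr)
  | sub (a b : Expr)
  /-- the array entry at `a`, `x`, `y` -/
  | load (a x y : Expr)
  /-- `a` if `c ≠ 0` and `b` otherwise -/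
  | ite (c a b : Expr)
  /-- the sum of `e` over all values of the variable `i` below the size bound -/
  | sum (i : ℕ) (e : Expr)

/-- Commands that modify the array. -/
inductive Cmd : Type
  /-- write `e` to the array entry at `a`, `x`, `y` -/
  | store (a x y e : Expr)
  | seq (c d : Cmd)
  /-- run `c` for all values of the variable `i` below the size bound, in increasing order -/
  | loop (i : ℕ) (c : Cmd)

/-- The value of an expression for the size bound `M`, the array `σ` and the variables `env`. -/
def Expr.eval (M : ℕ) (σ : ℕ → ℕ → ℕ → ℕ) : Expr → (ℕ → ℕ) → ℕ
  | .lit c, _ => c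
  | .var i, env => env i
  | .add a b, env => a.eval M σ env + b.eval M σ env
  | .sub a b, env => a.eval M σ env - b.eval M σ env
  | .load a x y, env => σ (a.eval M σ env) (x.eval M σ env) (y.eval M σ env)
  | .ite c a b, env => if c.eval M σ env ≠ 0 then a.eval M σ env else b.eval M σ env
  | .sum i e, env => ∑ t ∈ Finset.range M, e.eval M σ (Function.update env i t)

/-- The array `σ` with the entry at `a`, `x`, `y` replaced if `x` and `y` are below `M`. -/
def write (M : ℕ) (σ : ℕ → ℕ → ℕ → ℕ) (a x y v : ℕ) : ℕ → ℕ → ℕ → ℕ := fun a' x' y' =>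
  if a' = a ∧ x' = x ∧ y' = y ∧ x < M ∧ y < M then v else σ a' x' y'

/-- The effect of a command on the array. -/
def Cmd.run (M : ℕ) : Cmd → (ℕ → ℕ) → (ℕ → ℕ → ℕ → ℕ) → ℕ → ℕ → ℕ → ℕ
  | .store a x y e, env, σ =>
    write M σ (a.eval M σ env) (x.eval M σ env) (y.eval M σ env) (e.eval M σ env)
  | .seq c d, env, σ => d.run M env (c.run M env σ)
  | .loop i c, env, σ => Nat.rec σ (fun t τ => c.run M (Function.update env i t) τ) M

/-- The array that is kept in the memory `m`. -/
def view (M : ℕ) (m : ℕ → ℕ) : ℕ → ℕ → ℕ → ℕ := fun a x y =>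
  if x < M ∧ y < M then m ((a * M + x) * M + y) else 0

/-! ### Compilation

Register `1` holds the size bound, the register `2 * i` holds the variable `i`, and the registers
`2 * k + 3` are used for intermediate results. -/

/-- Multiply the intermediate result `k` by the size bound. -/
def mulBound (k j : ℕ) : Prog :=
  .seq (.const (2 * j + 3) 0) <| .seq (.move (2 * (j + 1) + 3) 1) <|
  .seq (.const (2 * (j + 2) + 3) 1) <|
  .seq (.loop (2 * (j + 1) + 3) <|
    .seq (.add (2 * j + 3) (2 * j + 3) (2 * k + 3))
      (.sub (2 * (j + 1) + 3) (2 * (j + 1) + 3) (2 * (j + 2) + 3))) <|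
  .move (2 * k + 3) (2 * j + 3)

/-- Compute the address of the array entry that is given by the intermediate results
`k`, `k + 1`, `k + 2`. -/
def address (k : ℕ) : Prog :=
  .seq (mulBound k (k + 4)) <| .seq (.add (2 * k + 3) (2 * k + 3) (2 * (k + 1) + 3)) <|
  .seq (mulBound k (k + 4)) (.add (2 * k + 3) (2 * k + 3) (2 * (k + 2) + 3))

/-- Run `p` if the intermediate results `k + 1` and `k + 2` are below the size bound, and `q`
otherwise. -/
def guardBounds (k : ℕ) (p q : Prog) : Prog :=
  .seq (.sub (2 * (k + 4) + 3) 1 (2 * (k + 1) + 3)) <| .cond (2 * (k + 4) + 3)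
    (.seq (.sub (2 * (k + 4) + 3) 1 (2 * (k + 2) + 3)) <| .cond (2 * (k + 4) + 3) p q) q

/-- A program that computes the expression into the intermediate result `k`. -/
def Expr.compile : Expr → ℕ → Prog
  | .lit c, k => .const (2 * k + 3) c
  | .var i, k => .move (2 * k + 3) (2 * i)
  | .add a b, k => .seq (a.compile k) <| .seq (b.compile (k + 1)) <|
      .add (2 * k + 3) (2 * k + 3) (2 * (k + 1) + 3)
  | .sub a b, k => .seq (a.compile k) <| .seq (b.compile (k + 1)) <|
      .sub (2 * k + 3) (2 * k + 3) (2 * (k + 1) + 3)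
  | .load a x y, k => .seq (a.compile k) <| .seq (x.compile (k + 1)) <|
      .seq (y.compile (k + 2)) <|
      guardBounds k (.seq (address k) (.load (2 * k + 3) (2 * k + 3))) (.const (2 * k + 3) 0)
  | .ite c a b, k => .seq (c.compile k) (.cond (2 * k + 3) (a.compile k) (b.compile k))
  | .sum i e, k => .seq (.move (2 * k + 3) (2 * i)) <| .seq (.const (2 * (k + 1) + 3) 0) <|
      .seq (.move (2 * (k + 2) + 3) 1) <|
      .seq (.loop (2 * (k + 2) + 3) <|
        .seq (.sub (2 * i) 1 (2 * (k + 2) + 3)) <| .seq (e.compile (k + 3)) <|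
        .seq (.add (2 * (k + 1) + 3) (2 * (k + 1) + 3) (2 * (k + 3) + 3)) <|
        .seq (.const (2 * (k + 3) + 3) 1)
          (.sub (2 * (k + 2) + 3) (2 * (k + 2) + 3) (2 * (k + 3) + 3))) <|
      .seq (.move (2 * i) (2 * k + 3)) (.move (2 * k + 3) (2 * (k + 1) + 3))

/-- A bound on the number of steps of the compiled expression. -/
def Expr.cost (M : ℕ) : Expr → ℕ
  | .lit _ => 1
  | .var _ => 1
  | .add a b => a.cost M + (b.cost M + 1)
  | .sub a b => a.cost M + (b.cost M + 1)
  | .load a x y => a.cost M + (x.cost M + (y.cost M + (6 * M + 30)))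
  | .ite c a b => c.cost M + (a.cost M + b.cost M + 1)
  | .sum _ e => e.cost M * M + 5 * M + 6

/-- A program that runs the command, with intermediate results from `k` on. -/
def Cmd.compile : Cmd → ℕ → Prog
  | .store a x y e, k => .seq (a.compile k) <| .seq (x.compile (k + 1)) <|
      .seq (y.compile (k + 2)) <| .seq (e.compile (k + 3)) <|
      guardBounds k (.seq (address k) (.store (2 * k + 3) (2 * (k + 3) + 3)))
        (.const (2 * k + 3) 0)
  | .seq c d, k => .seq (c.compile k) (d.compile k)
  | .loop i c, k => .seq (.move (2 * k + 3) (2 * i)) <|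
      .seq (.move (2 * (k + 1) + 3) 1) <|
      .seq (.loop (2 * (k + 1) + 3) <|
        .seq (.sub (2 * i) 1 (2 * (k + 1) + 3)) <| .seq (c.compile (k + 2)) <|
        .seq (.const (2 * (k + 2) + 3) 1)
          (.sub (2 * (k + 1) + 3) (2 * (k + 1) + 3) (2 * (k + 2) + 3))) <|
      .move (2 * i) (2 * k + 3)

/-- A bound on the number of steps of the compiled command. -/
def Cmd.cost (M : ℕ) : Cmd → ℕ
  | .store a x y e => a.cost M + (x.cost M + (y.cost M + (e.cost M + (6 * M + 30))))
  | .seq c d => c.cost M + d.cost M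
  | .loop _ c => c.cost M * M + 4 * M + 4

/-- The registers of `s` and `s'` agree, apart from intermediate results from `k` on. -/
def Agree (k : ℕ) (s s' : Store) : Prop :=
  ∀ r, r % 2 = 0 ∨ r < 2 * k + 3 → s'.reg r = s.reg r

theorem Agree.trans {k l : ℕ} {s₁ s₂ s₃ : Store} (h₁ : Agree k s₁ s₂) (h₂ : Agree l s₂ s₃)
    (h : k ≤ l) : Agree k s₁ s₃ := by
  intro r hr
  rw [h₂ r (by omega), h₁ r hr]

@[simp] theorem Store.setReg_mem (s : Store) (r v : ℕ) : (s.setReg r v).mem = s.mem := rfl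

theorem Store.setReg_reg (s : Store) (r v r' : ℕ) :
    (s.setReg r v).reg r' = if r' = r then v else s.reg r' := by
  simp [Store.setReg, Function.update_apply]

@[simp] theorem Store.setMem_reg (s : Store) (r v : ℕ) : (s.setMem r v).reg = s.reg := rfl

theorem Agree.setReg {k j v : ℕ} {s s' : Store} (h : Agree k s s') (hj : k ≤ j) :
    Agree k s (s'.setReg (2 * j + 3) v) := by
  intro r hr
  rw [Store.setReg_reg, if_neg (by omega), h r hr]

theorem Agree.refl (k : ℕ) (s : Store) : Agree k s s := fun _ _ => rfl

theorem Agree.var {k : ℕ} {s s' : Store} (h : Agree k s s') (i : ℕ) :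
    s'.reg (2 * i) = s.reg (2 * i) := h _ (by omega)

theorem Agree.bound {k : ℕ} {s s' : Store} (h : Agree k s s') : s'.reg 1 = s.reg 1 :=
  h _ (by omega)

theorem Agree.temp {k j : ℕ} {s s' : Store} (h : Agree k s s') (hj : j < k) :
    s'.reg (2 * j + 3) = s.reg (2 * j + 3) := h _ (by omega)

/-- Multiplication by repeated addition: intermediate results `j`, `j + 1`, `j + 2` are the
accumulator, the counter and the constant 1. As `k < j`, the factor in `k` survives the loop. -/
theorem runs_mulBound {k j : ℕ} (hkj : k < j) (s : Store) :
    Runs (mulBound k j) s (3 * s.reg 1 + 5) fun s' =>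
      s'.mem = s.mem ∧ s'.reg (2 * k + 3) = s.reg (2 * k + 3) * s.reg 1 ∧
      ∀ r, r % 2 = 0 ∨ r < 2 * j + 3 → r ≠ 2 * k + 3 → s'.reg r = s.reg r := by
  refine Runs.mono (T := 1 + (1 + (1 + ((s.reg 1 * ((1 + 1) + 1) + 1) + 1)))) ?_ (by omega)
    (fun _ h => h)
  refine .seq <| .const <| .seq <| .move <| .seq <| .const <| .seq ?_
  refine (Runs.loop (N := s.reg 1) (fun i s' => s'.mem = s.mem ∧
    s'.reg (2 * (j + 1) + 3) = s.reg 1 - i ∧ s'.reg (2 * (j + 2) + 3) = 1 ∧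
    s'.reg (2 * j + 3) = s.reg (2 * k + 3) * i ∧ Agree j s s') ?_ ?_ ?_).mono le_rfl ?_
  · intro i s' h
    exact h.2.1
  · rintro i hi s' ⟨hm, h1, h2, h3, h4⟩
    refine .seq <| .add <| .sub ?_
    refine ⟨by simpa using hm, ?_, ?_, ?_, (h4.setReg le_rfl).setReg (by omega)⟩
    · simp [Store.setReg_reg, h1, h2]
      omega
    · simp [Store.setReg_reg, h2]
    · simp [Store.setReg_reg, h3, h4.temp hkj, mul_add]
  · refine ⟨rfl, ?_, ?_, ?_, ?_⟩
    · simp [Store.setReg_reg]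
    · simp [Store.setReg_reg]
    · simp [Store.setReg_reg]
    · exact (((Agree.refl j s).setReg le_rfl).setReg (by omega)).setReg (by omega)
  · rintro s' ⟨hm, -, -, h3, h4⟩
    refine .move ⟨by simpa using hm, by simp [Store.setReg_reg, h3], fun r hr hk => ?_⟩
    rw [Store.setReg_reg, if_neg hk, h4 r hr]

/-- Horner evaluation of the base-`M` address. The scratch space starts at `k + 4`, so that the
value to be stored, kept in `k + 3`, is not overwritten. -/
theorem runs_address (k : ℕ) (s : Store) :
    Runs (address k) s (6 * s.reg 1 + 12) fun s' =>
      s'.mem = s.mem ∧ s'.reg (2 * k + 3) = (s.reg (2 * k + 3) * s.reg 1 +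
        s.reg (2 * (k + 1) + 3)) * s.reg 1 + s.reg (2 * (k + 2) + 3) ∧
      ∀ r, r % 2 = 0 ∨ r < 2 * (k + 4) + 3 → r ≠ 2 * k + 3 → s'.reg r = s.reg r := by
  refine Runs.mono (T := (3 * s.reg 1 + 5) + (1 + ((3 * s.reg 1 + 5) + 1))) ?_ (by omega)
    (fun _ h => h)
  refine .seq <| (runs_mulBound (by omega) s).mono le_rfl ?_
  rintro s₁ ⟨hm₁, hk₁, h₁⟩
  refine .seq <| .add <| .seq <| (runs_mulBound (by omega) _).mono ?_ ?_
  · simp [Store.setReg_reg, h₁ 1 (by omega) (by omega)]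
  rintro s₂ ⟨hm₂, hk₂, h₂⟩
  have e2 : s₂.reg (2 * (k + 2) + 3) = s.reg (2 * (k + 2) + 3) := by
    rw [h₂ _ (by omega) (by omega), Store.setReg_reg, if_neg (by omega), h₁ _ (by omega) (by omega)]
  refine .add ⟨by simp [hm₁, hm₂], ?_, ?_⟩
  · simp [Store.setReg_reg, hk₂, hk₁, e2, h₁ 1 (by omega) (by omega),
      h₁ (2 * (k + 1) + 3) (by omega) (by omega)]
  · intro r hr hk
    rw [Store.setReg_reg, if_neg hk, h₂ r hr hk, Store.setReg_reg, if_neg hk, h₁ r hr hk]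

/-- `U` counts twice because the fallback can be reached from either failed test. The scratch value
`v` is arbitrary, as neither branch relies on it. -/
theorem runs_guardBounds {k T U : ℕ} {p q : Prog} {s : Store} {Q : Store → Prop}
    (hp : ∀ v, s.reg (2 * (k + 1) + 3) < s.reg 1 → s.reg (2 * (k + 2) + 3) < s.reg 1 →
      Runs p (s.setReg (2 * (k + 4) + 3) v) T Q)
    (hq : ∀ v, ¬(s.reg (2 * (k + 1) + 3) < s.reg 1 ∧ s.reg (2 * (k + 2) + 3) < s.reg 1) →
      Runs q (s.setReg (2 * (k + 4) + 3) v) U Q) :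
    Runs (guardBounds k p q) s (T + 2 * U + 4) Q := by
  have hs : ∀ v w, (s.setReg (2 * (k + 4) + 3) v).setReg (2 * (k + 4) + 3) w =
      s.setReg (2 * (k + 4) + 3) w := by
    intro v w
    simp [Store.setReg]
  refine Runs.mono (T := 1 + ((1 + (T + U + 1)) + U + 1)) ?_ (by omega) (fun _ h => h)
  refine .seq <| .sub <| .cond (fun h1 => .seq <| .sub <| .cond (fun h2 => ?_) (fun h2 => ?_))
    (fun h1 => ?_)
  · rw [hs]
    simp [Store.setReg_reg] at h1 h2
    exact hp _ (by omega) (by omega)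
  · rw [hs]
    simp [Store.setReg_reg] at h1 h2
    exact hq _ (by omega)
  · simp [Store.setReg_reg] at h1
    exact hq _ (by omega)

/-- Structural induction with a stack discipline: the result goes to `k`, everything above `k` is
free, and further operands are computed higher up. Variables, the size bound and lower results
survive, so the induction hypotheses can be chained. -/
theorem Expr.runs_compile (e : Expr) : ∀ (k : ℕ) (s : Store),
    Runs (e.compile k) s (e.cost (s.reg 1)) fun s' =>
      s'.mem = s.mem ∧ Agree k s s' ∧
      s'.reg (2 * k + 3) = e.eval (s.reg 1) (view (s.reg 1) s.mem) fun i => s.reg (2 * i) := by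
  induction e with
  | lit c =>
    exact fun k s => .const ⟨rfl, (Agree.refl k s).setReg le_rfl, by
      simp [Store.setReg_reg, Expr.eval]⟩
  | var i =>
    exact fun k s => .move ⟨rfl, (Agree.refl k s).setReg le_rfl, by
      simp [Store.setReg_reg, Expr.eval]⟩
  | add a b iha ihb =>
    intro k s
    refine .seq <| (iha k s).mono le_rfl ?_
    rintro s₁ ⟨hm₁, h₁, e₁⟩
    refine .seq <| (ihb (k + 1) s₁).mono (by rw [h₁.bound]) ?_
    rintro s₂ ⟨hm₂, h₂, e₂⟩
    refine .add ⟨by simp [hm₁, hm₂], (h₁.trans h₂ (by omega)).setReg le_rfl, ?_⟩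
    simp only [h₁.bound, hm₁, h₁.var] at e₂
    simp [Store.setReg_reg, Expr.eval, h₂.temp, e₁, e₂]
  | sub a b iha ihb =>
    intro k s
    refine .seq <| (iha k s).mono le_rfl ?_
    rintro s₁ ⟨hm₁, h₁, e₁⟩
    refine .seq <| (ihb (k + 1) s₁).mono (by rw [h₁.bound]) ?_
    rintro s₂ ⟨hm₂, h₂, e₂⟩
    refine .sub ⟨by simp [hm₁, hm₂], (h₁.trans h₂ (by omega)).setReg le_rfl, ?_⟩
    simp only [h₁.bound, hm₁, h₁.var] at e₂
    simp [Store.setReg_reg, Expr.eval, h₂.temp, e₁, e₂]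
  | load a x y iha ihx ihy =>
    intro k s
    refine .seq <| (iha k s).mono le_rfl ?_
    rintro s₁ ⟨hm₁, h₁, e₁⟩
    refine .seq <| (ihx (k + 1) s₁).mono (by rw [h₁.bound]) ?_
    rintro s₂ ⟨hm₂, h₂, e₂⟩
    refine .seq <| (ihy (k + 2) s₂).mono (by rw [h₂.bound, h₁.bound]) ?_
    rintro s₃ ⟨hm₃, h₃, e₃⟩
    simp only [h₁.bound, h₂.bound, hm₁, hm₂, h₁.var, h₂.var] at e₂ e₃
    have h13 : Agree k s s₃ := (h₁.trans h₂ (by omega)).trans h₃ (by omega)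
    have e₂' := h₃.temp (show k + 1 < k + 2 by omega)
    have e₁' := (h₂.trans h₃ (by omega)).temp (show k < k + 1 by omega)
    rw [e₂] at e₂'
    rw [e₁] at e₁'
    refine (runs_guardBounds (T := 6 * s.reg 1 + 13) (U := 1) (fun v hx hy => ?_)
      (fun v hxy => ?_)).mono (by omega) (fun _ h => h)
    · refine Runs.seq (T := 6 * s.reg 1 + 12) (U := 1) <| (runs_address k _).mono ?_ ?_
      · simp [Store.setReg_reg, h13.bound]
      rintro s₄ ⟨hm₄, e₄, h₄⟩
      refine .load ⟨by simp [hm₁, hm₂, hm₃, hm₄], ?_, ?_⟩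
      · intro r hr
        rw [Store.setReg_reg, if_neg (by omega), h₄ r (by omega) (by omega), Store.setReg_reg,
          if_neg (by omega), h13 r hr]
      · simp [Store.setReg_reg, e₁', e₂', e₃, h13.bound] at e₄
        rw [e₂', h13.bound] at hx
        rw [e₃, h13.bound] at hy
        simp [Store.setReg_reg, e₄, Expr.eval, hm₁, hm₂, hm₃, hm₄]
        rw [view, if_pos ⟨hx, hy⟩]
    · refine .const ⟨by simp [hm₁, hm₂, hm₃], (h13.setReg (by omega)).setReg le_rfl, ?_⟩
      rw [e₂', e₃, h13.bound] at hxy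
      simp only [Store.setReg_reg, Expr.eval]
      rw [view, if_neg hxy, if_pos trivial]
  | ite c a b ihc iha ihb =>
    intro k s
    refine .seq <| (ihc k s).mono le_rfl ?_
    rintro s₁ ⟨hm₁, h₁, e₁⟩
    have ha := iha k s₁
    have hb := ihb k s₁
    simp only [h₁.bound, hm₁, h₁.var] at ha hb
    refine .cond (fun h => ha.mono le_rfl ?_) (fun h => hb.mono le_rfl ?_)
    · rintro s₂ ⟨hm₂, h₂, e₂⟩
      rw [e₁] at h
      exact ⟨by simp [hm₂], h₁.trans h₂ le_rfl, by rw [e₂, Expr.eval, if_pos h]⟩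
    · rintro s₂ ⟨hm₂, h₂, e₂⟩
      rw [e₁] at h
      exact ⟨by simp [hm₂], h₁.trans h₂ le_rfl, by rw [e₂, Expr.eval, if_neg (by simpa using h)]⟩
  | sum i e ih =>
    intro k s
    refine Runs.mono (T := 1 + (1 + (1 + ((s.reg 1 * ((1 + (e.cost (s.reg 1) + (1 + (1 + 1)))) + 1)
      + 1) + (1 + 1))))) ?_ (by rw [Expr.cost]; ring_nf; omega) (fun _ h => h)
    refine .seq <| .move <| .seq <| .const <| .seq <| .move <| .seq ?_
    -- Slot `k` saves the old value of the bound variable, `k + 1` accumulates and `k + 2` counts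
    -- down. The frame condition omits the bound variable, which is restored after the loop.
    refine (Runs.loop (N := s.reg 1) (fun t s' => s'.mem = s.mem ∧
      s'.reg (2 * (k + 2) + 3) = s.reg 1 - t ∧
      s'.reg (2 * (k + 1) + 3) = ∑ t ∈ Finset.range t,
        e.eval (s.reg 1) (view (s.reg 1) s.mem) (Function.update (fun i => s.reg (2 * i)) i t) ∧
      s'.reg (2 * k + 3) = s.reg (2 * i) ∧
      ∀ r, r % 2 = 0 ∨ r < 2 * k + 3 → r ≠ 2 * i → s'.reg r = s.reg r) ?_ ?_ ?_).mono le_rfl ?_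
    · intro t s' h
      exact h.2.1
    · rintro t ht s' ⟨hm, hc, hsum, hi, h⟩
      have hM : s'.reg 1 = s.reg 1 := h 1 (by omega) (by omega)
      refine .seq <| .sub <| .seq <| (ih (k + 3) _).mono ?_ ?_
      · rw [Store.setReg_reg, if_neg (by omega), hM]
      rintro s₁ ⟨hm₁, h₁, e₁⟩
      -- The counter holds `M - t`, so the bound variable becomes `M - (M - t) = t`: a decreasing
      -- counter gives increasing values.
      have henv : (fun j => (s'.setReg (2 * i) (s'.reg 1 - s'.reg (2 * (k + 2) + 3))).reg (2 * j)) =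
          Function.update (fun j => s.reg (2 * j)) i t := by
        funext j
        rw [hM, hc, Nat.sub_sub_self ht.le]
        simp only [Store.setReg_reg, Function.update_apply]
        split_ifs with h1 h2 h2
        · rfl
        · omega
        · omega
        · exact h _ (by omega) h1
      rw [henv] at e₁
      simp only [Store.setReg_reg, Store.setReg_mem, hm] at e₁ hm₁
      rw [if_neg (by omega), hM] at e₁
      have r1 : s₁.reg (2 * (k + 1) + 3) = s'.reg (2 * (k + 1) + 3) := by
        rw [h₁.temp (by omega), Store.setReg_reg, if_neg (by omega)]
      have r2 : s₁.reg (2 * (k + 2) + 3) = s'.reg (2 * (k + 2) + 3) := by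
        rw [h₁.temp (by omega), Store.setReg_reg, if_neg (by omega)]
      refine .seq <| .add <| .seq <| .const <| .sub ⟨by simp [hm₁], ?_, ?_, ?_, ?_⟩
      · simp [Store.setReg_reg, r2, hc]
        omega
      · simp [Store.setReg_reg, r1, hsum, e₁, Finset.sum_range_succ]
      · simp [Store.setReg_reg, ← hi]
        rw [h₁.temp (by omega), Store.setReg_reg, if_neg (by omega)]
      · intro r hr hri
        rw [Store.setReg_reg, if_neg (by omega), Store.setReg_reg, if_neg (by omega),
          Store.setReg_reg, if_neg (by omega), h₁ r (by omega), Store.setReg_reg, if_neg hri,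
          h r hr hri]
    · refine ⟨rfl, ?_, ?_, ?_, ?_⟩
      · simp [Store.setReg_reg]
      · simp [Store.setReg_reg]
      · simp [Store.setReg_reg]
      · exact fun r hr hri => (((Agree.refl k s).setReg le_rfl).setReg (by omega)).setReg
          (by omega) r hr
    · rintro s' ⟨hm, hc, hsum, hi, h⟩
      refine .seq <| .move <| .move ⟨by simpa using hm, ?_, ?_⟩
      · intro r hr
        rw [Store.setReg_reg, if_neg (by omega), Store.setReg_reg]
        split_ifs with hri
        · rw [hi, hri]
        · exact h r hr hri
      · rw [Store.setReg_reg, if_pos rfl, Store.setReg_reg, if_neg (by omega), hsum]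
        rfl

/-- Uniqueness of base-`M` digits: for `x`, `y` below `M` distinct index triples have distinct
addresses, so one memory write changes one entry. -/
theorem view_setMem {M : ℕ} {m : ℕ → ℕ} {a x y v : ℕ} (hx : x < M) (hy : y < M) :
    view M (Function.update m ((a * M + x) * M + y) v) = write M (view M m) a x y v := by
  funext a' x' y'
  simp only [view, write, Function.update_apply]
  by_cases h : x' < M ∧ y' < M
  · have hinj : ∀ p q r t : ℕ, q < M → t < M → p * M + q = r * M + t → p = r ∧ q = t := by
      intro p q r t hq ht h
      have hM : 0 < M := by omega
      constructor
      · have := congrArg (· / M) h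
        simpa [mul_comm _ M, Nat.mul_add_div hM, Nat.div_eq_of_lt hq, Nat.div_eq_of_lt ht]
          using this
      · have := congrArg (· % M) h
        simpa [mul_comm _ M, Nat.mul_add_mod, Nat.mod_eq_of_lt hq, Nat.mod_eq_of_lt ht] using this
    rw [if_pos h, if_pos h]
    congr 1
    refine propext ⟨fun h' => ?_, fun h' => by rw [h'.1, h'.2.1, h'.2.2.1]⟩
    obtain ⟨h1, h2⟩ := hinj _ _ _ _ h.2 hy h'
    obtain ⟨h3, h4⟩ := hinj _ _ _ _ h.1 hx h1
    exact ⟨h3, h4, h2, hx, hy⟩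
  · rw [if_neg h, if_neg h, if_neg]
    rintro ⟨-, rfl, rfl, -⟩
    exact h ⟨hx, hy⟩

/-- The same stack discipline as for expressions, but only the view of the memory as an array is
tracked, since this is all that later commands read. -/
theorem Cmd.runs_compile (c : Cmd) : ∀ (k : ℕ) (s : Store),
    Runs (c.compile k) s (c.cost (s.reg 1)) fun s' => Agree k s s' ∧
      view (s.reg 1) s'.mem =
        c.run (s.reg 1) (fun i => s.reg (2 * i)) (view (s.reg 1) s.mem) := by
  induction c with
  | store a x y e =>
    intro k s
    refine .seq <| (a.runs_compile k s).mono le_rfl ?_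
    rintro s₁ ⟨hm₁, h₁, e₁⟩
    refine .seq <| (x.runs_compile (k + 1) s₁).mono (by rw [h₁.bound]) ?_
    rintro s₂ ⟨hm₂, h₂, e₂⟩
    refine .seq <| (y.runs_compile (k + 2) s₂).mono (by rw [h₂.bound, h₁.bound]) ?_
    rintro s₃ ⟨hm₃, h₃, e₃⟩
    refine .seq <| (e.runs_compile (k + 3) s₃).mono (by rw [h₃.bound, h₂.bound, h₁.bound]) ?_
    rintro s₄ ⟨hm₄, h₄, e₄⟩
    simp only [h₁.bound, h₂.bound, h₃.bound, hm₁, hm₂, hm₃, h₁.var, h₂.var, h₃.var] at e₂ e₃ e₄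
    have h14 : Agree k s s₄ :=
      ((h₁.trans h₂ (by omega)).trans h₃ (by omega)).trans h₄ (by omega)
    have e₃' := h₄.temp (show k + 2 < k + 3 by omega)
    have e₂' := (h₃.trans h₄ (by omega)).temp (show k + 1 < k + 2 by omega)
    have e₁' := ((h₂.trans h₃ (by omega)).trans h₄ (by omega)).temp (show k < k + 1 by omega)
    rw [e₃] at e₃'
    rw [e₂] at e₂'
    rw [e₁] at e₁'
    refine (runs_guardBounds (T := 6 * s.reg 1 + 13) (U := 1) (fun v hx hy => ?_)
      (fun v hxy => ?_)).mono (by omega) (fun _ h => h)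
    · refine Runs.seq (T := 6 * s.reg 1 + 12) (U := 1) <| (runs_address k _).mono ?_ ?_
      · simp [Store.setReg_reg, h14.bound]
      rintro s₅ ⟨hm₅, e₅, h₅⟩
      refine .store ⟨?_, ?_⟩
      · intro r hr
        by_cases hrk : r = 2 * k + 3
        · omega
        · rw [Store.setMem_reg, h₅ r (by omega) hrk, Store.setReg_reg, if_neg (by omega),
            h14 r hr]
      · simp [Store.setReg_reg, e₁', e₂', e₃', h14.bound] at e₅
        rw [e₂', h14.bound] at hx
        rw [e₃', h14.bound] at hy
        have e₄' : s₅.reg (2 * (k + 3) + 3) = s₄.reg (2 * (k + 3) + 3) := by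
          rw [h₅ _ (by omega) (by omega), Store.setReg_reg, if_neg (by omega)]
        simp only [Store.setMem, e₅, e₄', e₄, hm₅, Store.setReg_mem, hm₄, hm₃, hm₂, hm₁]
        exact view_setMem hx hy
    · refine .const ⟨(h14.setReg (by omega)).setReg le_rfl, ?_⟩
      rw [e₂', e₃', h14.bound] at hxy
      simp only [Store.setReg_mem, hm₄, hm₃, hm₂, hm₁, Cmd.run]
      funext a' x' y'
      rw [write, if_neg]
      exact fun h => hxy h.2.2.2
  | seq c d ihc ihd =>
    intro k s
    refine .seq <| (ihc k s).mono le_rfl ?_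
    rintro s₁ ⟨h₁, e₁⟩
    refine (ihd k s₁).mono (by rw [h₁.bound]) ?_
    rintro s₂ ⟨h₂, e₂⟩
    refine ⟨h₁.trans h₂ le_rfl, ?_⟩
    simp only [h₁.bound, h₁.var, e₁] at e₂
    exact e₂
  | loop i c ih =>
    intro k s
    refine Runs.mono (T := 1 + (1 + ((s.reg 1 * ((1 + (c.cost (s.reg 1) + (1 + 1))) + 1)
      + 1) + 1))) ?_ (by rw [Cmd.cost]; ring_nf; omega) (fun _ h => h)
    refine .seq <| .move <| .seq <| .move <| .seq ?_
    refine (Runs.loop (N := s.reg 1) (fun t s' =>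
      s'.reg (2 * (k + 1) + 3) = s.reg 1 - t ∧
      view (s.reg 1) s'.mem = Nat.rec (view (s.reg 1) s.mem)
        (fun t τ => c.run (s.reg 1) (Function.update (fun i => s.reg (2 * i)) i t) τ) t ∧
      s'.reg (2 * k + 3) = s.reg (2 * i) ∧
      ∀ r, r % 2 = 0 ∨ r < 2 * k + 3 → r ≠ 2 * i → s'.reg r = s.reg r) ?_ ?_ ?_).mono le_rfl ?_
    · intro t s' h
      exact h.1
    · rintro t ht s' ⟨hc, hrun, hi, h⟩
      have hM : s'.reg 1 = s.reg 1 := h 1 (by omega) (by omega)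
      refine .seq <| .sub <| .seq <| (ih (k + 2) _).mono ?_ ?_
      · rw [Store.setReg_reg, if_neg (by omega), hM]
      rintro s₁ ⟨h₁, e₁⟩
      have henv : (fun j => (s'.setReg (2 * i) (s'.reg 1 - s'.reg (2 * (k + 1) + 3))).reg (2 * j)) =
          Function.update (fun j => s.reg (2 * j)) i t := by
        funext j
        rw [hM, hc, Nat.sub_sub_self ht.le]
        simp only [Store.setReg_reg, Function.update_apply]
        split_ifs with h1 h2 h2
        · rfl
        · omega
        · omega
        · exact h _ (by omega) h1
      rw [henv] at e₁
      simp only [Store.setReg_reg, Store.setReg_mem] at e₁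
      rw [if_neg (by omega), hM, hrun] at e₁
      have r1 : s₁.reg (2 * (k + 1) + 3) = s'.reg (2 * (k + 1) + 3) := by
        rw [h₁.temp (by omega), Store.setReg_reg, if_neg (by omega)]
      refine .seq <| .const <| .sub ⟨?_, ?_, ?_, ?_⟩
      · simp [Store.setReg_reg, r1, hc]
        omega
      · simpa using e₁
      · simp [Store.setReg_reg, ← hi]
        rw [h₁.temp (by omega), Store.setReg_reg, if_neg (by omega)]
      · intro r hr hri
        rw [Store.setReg_reg, if_neg (by omega), Store.setReg_reg, if_neg (by omega),
          h₁ r (by omega), Store.setReg_reg, if_neg hri, h r hr hri]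
    · refine ⟨?_, rfl, ?_, ?_⟩
      · simp [Store.setReg_reg]
      · simp [Store.setReg_reg]
      · exact fun r hr hri => ((Agree.refl k s).setReg le_rfl).setReg (by omega) r hr
    · rintro s' ⟨hc, hrun, hi, h⟩
      refine .move ⟨?_, ?_⟩
      · intro r hr
        rw [Store.setReg_reg]
        split_ifs with hri
        · rw [hi, hri]
        · exact h r hr hri
      · rw [Store.setReg_mem, hrun]
        rfl

/-! ### Polynomial running time -/

/-- The function is bounded by a polynomial at the positive integers. -/
def PolyBounded (f : ℕ → ℕ) : Prop := ∃ K d : ℕ, ∀ M, 1 ≤ M → f M ≤ K * M ^ d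

theorem PolyBounded.const (c : ℕ) : PolyBounded fun _ => c := ⟨c, 0, fun _ _ => by simp⟩

theorem PolyBounded.id : PolyBounded fun M => M := ⟨1, 1, fun _ _ => by simp⟩

theorem PolyBounded.add {f g : ℕ → ℕ} (hf : PolyBounded f) (hg : PolyBounded g) :
    PolyBounded fun M => f M + g M := by
  obtain ⟨K, d, h⟩ := hf
  obtain ⟨K', d', h'⟩ := hg
  -- The common exponent `d + d'` serves as an upper bound for both; raising an exponent needs `1 ≤
  -- M`.
  refine ⟨K + K', d + d', fun M hM => ?_⟩
  rw [add_mul]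
  exact add_le_add
    ((h M hM).trans (Nat.mul_le_mul_left _ (Nat.pow_le_pow_right hM (by omega))))
    ((h' M hM).trans (Nat.mul_le_mul_left _ (Nat.pow_le_pow_right hM (by omega))))

theorem PolyBounded.mul {f g : ℕ → ℕ} (hf : PolyBounded f) (hg : PolyBounded g) :
    PolyBounded fun M => f M * g M := by
  obtain ⟨K, d, h⟩ := hf
  obtain ⟨K', d', h'⟩ := hg
  refine ⟨K * K', d + d', fun M hM => (Nat.mul_le_mul (h M hM) (h' M hM)).trans_eq ?_⟩
  ring

theorem PolyBounded.comp_pow {f : ℕ → ℕ} (hf : PolyBounded f) (m : ℕ) :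
    PolyBounded fun M => f (M ^ m) := by
  obtain ⟨K, d, h⟩ := hf
  exact ⟨K, m * d, fun M hM => by rw [pow_mul]; exact h _ (Nat.one_le_pow _ _ hM)⟩

theorem Expr.polyBounded_cost (e : Expr) : PolyBounded fun M => e.cost M := by
  induction e with
  | lit c => exact .const 1
  | var i => exact .const 1
  | add a b iha ihb => exact iha.add (ihb.add (.const 1))
  | sub a b iha ihb => exact iha.add (ihb.add (.const 1))
  | load a x y iha ihx ihy =>
    exact iha.add (ihx.add (ihy.add (((PolyBounded.const 6).mul .id).add (.const 30))))
  | ite c a b ihc iha ihb => exact ihc.add ((iha.add ihb).add (.const 1))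
  | sum i e ih => exact ((ih.mul .id).add ((PolyBounded.const 5).mul .id)).add (.const 6)

theorem Cmd.polyBounded_cost (c : Cmd) : PolyBounded fun M => c.cost M := by
  induction c with
  | store a x y e =>
    exact a.polyBounded_cost.add (x.polyBounded_cost.add (y.polyBounded_cost.add
      (e.polyBounded_cost.add (((PolyBounded.const 6).mul .id).add (.const 30)))))
  | seq c d ihc ihd => exact ihc.add ihd
  | loop i c ih => exact ((ih.mul .id).add ((PolyBounded.const 4).mul .id)).add (.const 4)

/-- Square the size bound. -/
def squareBound : Prog :=
  .seq ((Expr.sum 0 (.sum 0 (.lit 1))).compile 0) (.move 1 (2 * 0 + 3))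

/-- A double sum of ones counts `M ^ 2`. Both sums may use variable 0, the order of the graph,
because a compiled sum restores its variable. -/
theorem runs_squareBound (s : Store) :
    Runs squareBound s ((Expr.sum 0 (.sum 0 (.lit 1))).cost (s.reg 1) + 1) fun s' =>
      s'.mem = s.mem ∧ s'.reg 1 = s.reg 1 ^ 2 ∧ ∀ i, s'.reg (2 * i) = s.reg (2 * i) := by
  refine .seq <| (Expr.runs_compile _ 0 s).mono le_rfl ?_
  rintro s' ⟨hm, h, he⟩
  refine .move ⟨by simpa using hm, ?_, fun i => ?_⟩
  · rw [Store.setReg_reg, if_pos rfl, he]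
    simp [Expr.eval, sq]
  · rw [Store.setReg_reg, if_neg (by omega), h.var]

/-- Run the command with size bound `n ^ 8`, where `n` is the contents of register `0`, and then
put the value of the expression into register `0`. -/
def program (c : Cmd) (e : Expr) : Prog :=
  .seq (.move 1 0) <| .seq squareBound <| .seq squareBound <| .seq squareBound <|
  .seq (c.compile 0) <| .seq (e.compile 0) (.move 0 (2 * 0 + 3))

/-- The variables at the start of a program on a graph of order `n`. -/
def initEnv (n : ℕ) : ℕ → ℕ := fun i => if i = 0 then n else 0

/-- A constant factor `K` is absorbed into the exponent by `K < 2 ^ K ≤ n ^ K`; this is where `2 ≤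
n` enters. -/
theorem exists_runs_program (c : Cmd) (e : Expr) : ∃ d : ℕ, ∀ (n : ℕ), 2 ≤ n →
    ∀ G : SimpleGraph (Fin n),
      Runs (program c e) (input G) (n ^ d) fun s => s.reg 0 =
        e.eval (n ^ 8) (c.run (n ^ 8) (initEnv n) (view (n ^ 8) (input G).mem)) (initEnv n) := by
  have hsq := (Expr.sum 0 (.sum 0 (.lit 1))).polyBounded_cost.add (.const 1)
  -- The summands follow the program: squarings at size bounds `n`, `n ^ 2` and `n ^ 4`, then the
  -- command and the expression at `n ^ 8`.
  obtain ⟨K, d, h⟩ := (PolyBounded.const 1).add <| (hsq.comp_pow 1).add <| (hsq.comp_pow 2).add <|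
    (hsq.comp_pow 4).add <| (c.polyBounded_cost.comp_pow 8).add <|
    (e.polyBounded_cost.comp_pow 8).add (.const 1)
  refine ⟨K + d, fun n hn G => ?_⟩
  refine Runs.mono (T := _) ?_ ((h n (by omega)).trans ?_) (fun _ h => h)
  · refine .seq <| .move <| .seq <| (runs_squareBound _).mono ?_ ?_
    · simp [Store.setReg_reg, input]
    rintro s₁ ⟨hm₁, hM₁, h₁⟩
    have hM₁ : s₁.reg 1 = n ^ 2 := by simpa [Store.setReg_reg, input] using hM₁
    refine .seq <| (runs_squareBound _).mono (by rw [hM₁]) ?_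
    rintro s₂ ⟨hm₂, hM₂, h₂⟩
    have hM₂ : s₂.reg 1 = n ^ 4 := by rw [hM₂, hM₁]; ring
    refine .seq <| (runs_squareBound _).mono (by rw [hM₂]) ?_
    rintro s₃ ⟨hm₃, hM₃, h₃⟩
    have hM₃ : s₃.reg 1 = n ^ 8 := by rw [hM₃, hM₂]; ring
    have henv : (fun i => s₃.reg (2 * i)) = initEnv n := by
      funext i
      rw [h₃, h₂, h₁, Store.setReg_reg, if_neg (by omega), initEnv]
      simp [input]
    have hmem : s₃.mem = (input G).mem := by rw [hm₃, hm₂, hm₁]; rfl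
    refine .seq <| (c.runs_compile 0 s₃).mono (by rw [hM₃]) ?_
    rintro s₄ ⟨h₄, e₄⟩
    rw [hM₃, henv, hmem] at e₄
    refine .seq <| (e.runs_compile 0 s₄).mono (by rw [h₄.bound, hM₃]) ?_
    rintro s₅ ⟨-, -, e₅⟩
    simp only [h₄.bound, hM₃, h₄.var, henv, e₄] at e₅
    refine .move ?_
    rw [Store.setReg_reg, if_pos rfl, e₅]
  · rw [pow_add]
    exact Nat.mul_le_mul_right _ (K.lt_two_pow_self.le.trans (Nat.pow_le_pow_left hn K))

end RAM

/-! ### Elimination of variables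

The literal `3 * v + l` says that the vertex `v` has the label `l < 3`, and the literal `3 * n` is
always true. -/

/-- The literals that are true for the labelling `f` of `0, …, n - 1`. -/
def IsTrueLit (n : ℕ) (f : ℕ → ℕ) (x : ℕ) : Prop := x = 3 * n ∨ ∃ v < n, x = 3 * v + f v

/-- If no clash between true literals is derivable, then the variables can be given values one
by one, in reverse order of their elimination. -/
theorem exists_labelling_of_elimination {n : ℕ} {F : ℕ → ℕ → ℕ → Prop}
    (hstep : ∀ k < n, ∀ x ≤ 3 * n, ∀ y ≤ 3 * n, F (k + 1) x y ↔
      F k x y ∨ ∀ l < 3, F k (3 * k + l) x ∨ F k (3 * k + l) y)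
    (hsymm : ∀ x ≤ 3 * n, ∀ y ≤ 3 * n, F 0 x y → F 0 y x)
    (hdiag : ∀ x ≤ 3 * n, ∀ y ≤ 3 * n, F 0 x x → F 0 x y)
    (hlist : ∀ v < n, ∃ l < 3, ∀ y ≤ 3 * n, F 0 (3 * v + l) y)
    (hend : ¬F n (3 * n) (3 * n)) :
    ∃ f : ℕ → ℕ, (∀ v < n, f v < 3) ∧
      ∀ x y, IsTrueLit n f x → IsTrueLit n f y → ¬F 0 x y := by
  have hsymm' : ∀ k ≤ n, ∀ x ≤ 3 * n, ∀ y ≤ 3 * n, F k x y → F k y x := by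
    intro k
    induction k with
    | zero => exact fun _ => hsymm
    | succ k ih =>
      intro hk x hx y hy
      rw [hstep k hk x hx y hy, hstep k hk y hy x hx]
      rintro (h | h)
      · exact .inl (ih (by omega) x hx y hy h)
      · exact .inr fun l hl => (h l hl).symm
  have hdiag' : ∀ k ≤ n, ∀ x ≤ 3 * n, ∀ y ≤ 3 * n, F k x x → F k x y := by
    intro k
    induction k with
    | zero => exact fun _ => hdiag
    | succ k ih =>
      intro hk x hx y hy
      rw [hstep k hk x hx y hy, hstep k hk x hx x hx]
      rintro (h | h)
      · exact .inl (ih (by omega) x hx y hy h)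
      · exact .inr fun l hl => .inl (by simpa using h l hl)
  have hlist' : ∀ k ≤ n, ∀ v < n, ∃ l < 3, ∀ y ≤ 3 * n, F k (3 * v + l) y := by
    intro k hk v hv
    obtain ⟨l, hl, h⟩ := hlist v hv
    refine ⟨l, hl, ?_⟩
    induction k with
    | zero => exact h
    | succ k ih =>
      intro y hy
      rw [hstep k hk _ (by omega) y hy]
      exact .inl (ih (by omega) y hy)
  have key : ∀ m ≤ n, ∃ f : ℕ → ℕ, (∀ v < n, f v < 3) ∧ ∀ x y,
      (x = 3 * n ∨ ∃ v < n, n - m ≤ v ∧ x = 3 * v + f v) →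
      (y = 3 * n ∨ ∃ v < n, n - m ≤ v ∧ y = 3 * v + f v) → ¬F (n - m) x y := by
    intro m
    induction m with
    | zero =>
      refine fun _ => ⟨fun _ => 0, fun _ _ => Nat.zero_lt_succ 2, ?_⟩
      rintro x y (rfl | ⟨v, hv, hv', -⟩) (rfl | ⟨w, hw, hw', -⟩)
      · exact hend
      all_goals omega
    | succ m ih =>
      intro hm
      obtain ⟨f, hf, hF⟩ := ih (by omega)
      set k := n - (m + 1) with hk
      have hkm : n - m = k + 1 := by omega
      have hkn : k < n := by omega
      rw [hkm] at hF
      -- `A` consists of the literals already made true, including the constant one.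
      set A : Set ℕ := {x | x = 3 * n ∨ ∃ v < n, k + 1 ≤ v ∧ x = 3 * v + f v} with hA
      have hA3 : ∀ x ∈ A, x ≤ 3 * n := by
        rintro x (rfl | ⟨v, hv, -, rfl⟩)
        · exact le_rfl
        · have := hf v hv
          omega
      -- The label `l₀` clashes with every literal. If the other two labels were blocked by `y` and
      -- `z` in `A`, eliminating `k` would have produced a clash of `y` with `z`. Two blocking
      -- literals suffice exactly because one label is impossible; this is the 2-satisfiability
      -- feature.
      obtain ⟨l, hl, hfree⟩ : ∃ l < 3, ∀ y ∈ A, ¬F k (3 * k + l) y := by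
        by_contra! hcon
        obtain ⟨l₀, hl₀, h₀⟩ := hlist' k hkn.le k hkn
        have hx : ∃ y z, y ∈ A ∧ z ∈ A ∧ ∀ l < 3, F k (3 * k + l) y ∨ F k (3 * k + l) z := by
          obtain ⟨y₀, hy₀, h0⟩ := hcon 0 (by omega)
          obtain ⟨y₁, hy₁, h1⟩ := hcon 1 (by omega)
          obtain ⟨y₂, hy₂, h2⟩ := hcon 2 (by omega)
          have h3 : l₀ = 0 ∨ l₀ = 1 ∨ l₀ = 2 := by omega
          rcases h3 with rfl | rfl | rfl
          · refine ⟨y₁, y₂, hy₁, hy₂, fun l hl => ?_⟩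
            interval_cases l
            · exact .inl (h₀ _ (hA3 _ hy₁))
            · exact .inl h1
            · exact .inr h2
          · refine ⟨y₀, y₂, hy₀, hy₂, fun l hl => ?_⟩
            interval_cases l
            · exact .inl h0
            · exact .inl (h₀ _ (hA3 _ hy₀))
            · exact .inr h2
          · refine ⟨y₀, y₁, hy₀, hy₁, fun l hl => ?_⟩
            interval_cases l
            · exact .inl h0
            · exact .inr h1
            · exact .inl (h₀ _ (hA3 _ hy₀))
        obtain ⟨y, z, hy, hz, hyz⟩ := hx
        exact hF y z hy hz ((hstep k hkn y (hA3 y hy) z (hA3 z hz)).2 (.inr hyz))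
      refine ⟨Function.update f k l, fun v hv => ?_, ?_⟩
      · rw [Function.update_apply]
        split_ifs
        exacts [hl, hf v hv]
      · have hmem : ∀ x, (x = 3 * n ∨ ∃ v < n, k ≤ v ∧ x = 3 * v + Function.update f k l v) →
            x ∈ A ∨ x = 3 * k + l := by
          rintro x (rfl | ⟨v, hv, hkv, rfl⟩)
          · exact .inl (.inl rfl)
          · rw [Function.update_apply]
            split_ifs with h
            · exact .inr (by rw [h])
            · exact .inl (.inr ⟨v, hv, by omega, rfl⟩)
        have hkl : 3 * k + l ≤ 3 * n := by omega
        intro x y hx hy hxy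
        rcases hmem x hx with hx | rfl <;> rcases hmem y hy with hy | rfl
        · exact hF x y hx hy ((hstep k hkn x (hA3 x hx) y (hA3 y hy)).2 (.inl hxy))
        · exact hfree x hx (hsymm' k hkn.le x (hA3 x hx) _ hkl hxy)
        · exact hfree y hy hxy
        -- A literal clashing with itself is false, so it also clashes with the constant true
        -- literal, which lies in `A`.
        · exact hfree (3 * n) (.inl rfl) (hdiag' k hkn.le _ hkl _ le_rfl hxy)
  obtain ⟨f, hf, hF⟩ := key n le_rfl
  rw [Nat.sub_self] at hF
  refine ⟨f, hf, fun x y hx hy => hF x y (hx.imp_right ?_) (hy.imp_right ?_)⟩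
  · rintro ⟨v, hv, h⟩
    exact ⟨v, hv, by omega, h⟩
  · rintro ⟨v, hv, h⟩
    exact ⟨v, hv, by omega, h⟩

/-- Elimination derives no clash between literals that are true for a solution. -/
theorem not_clash_of_elimination {n : ℕ} {F : ℕ → ℕ → ℕ → Prop}
    (hstep : ∀ k < n, ∀ x ≤ 3 * n, ∀ y ≤ 3 * n, F (k + 1) x y ↔
      F k x y ∨ ∀ l < 3, F k (3 * k + l) x ∨ F k (3 * k + l) y)
    {f : ℕ → ℕ} (hf : ∀ v < n, f v < 3)
    (hF : ∀ x y, IsTrueLit n f x → IsTrueLit n f y → ¬F 0 x y) : ¬F n (3 * n) (3 * n) := by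
  have hle : ∀ x, IsTrueLit n f x → x ≤ 3 * n := by
    rintro x (rfl | ⟨v, hv, rfl⟩)
    · exact le_rfl
    · have := hf v hv
      omega
  have key : ∀ k ≤ n, ∀ x y, IsTrueLit n f x → IsTrueLit n f y → ¬F k x y := by
    intro k
    induction k with
    | zero => exact fun _ => hF
    | succ k ih =>
      intro hk x y hx hy
      rw [hstep k hk x (hle x hx) y (hle y hy)]
      rintro (h | h)
      · exact ih (by omega) x y hx hy h
      · have hv : IsTrueLit n f (3 * k + f k) := .inr ⟨k, hk, rfl⟩
        rcases h (f k) (hf k hk) with h | h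
        · exact ih (by omega) _ _ hv hx h
        · exact ih (by omega) _ _ hv hy h
  exact key n le_rfl _ _ (.inl rfl) (.inl rfl)

/-! ### Guessing the labels of a greedy dominating set

The label `0` stands for the cut, and the labels `1` and `2` for the two sides. Adjacent vertices
may have any labels whose sum is neither `0` nor `3`. -/

section Greedy

variable (n : ℕ) (adj : ℕ → ℕ → Prop)

/-- No label of `u` has been excluded. -/
def Undetermined (X : ℕ → Prop) (u : ℕ) : Prop := ∀ l < 3, ¬X (3 * u + l)

open Classical in
/-- The number of vertices with no excluded label. -/
noncomputable def numUndetermined (X : ℕ → Prop) : ℕ :=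
  ((Finset.range n).filter fun u => Undetermined X u).card

open Classical in
/-- The number of vertices with no excluded label in the closed neighbourhood of `d`. -/
noncomputable def cover (X : ℕ → Prop) (d : ℕ) : ℕ :=
  ((Finset.range n).filter fun u => Undetermined X u ∧ (u = d ∨ adj d u)).card

/-- `d` is the first vertex that dominates at least half of the undetermined vertices. -/
def Chosen (X : ℕ → Prop) (d : ℕ) : Prop :=
  d < n ∧ numUndetermined n X ≤ 2 * cover n adj X d ∧
    ∀ d' < d, ¬numUndetermined n X ≤ 2 * cover n adj X d'

/-- The literal `x` is excluded by giving the label `l` to `d`. -/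
def Excludes (d l x : ℕ) : Prop :=
  ∃ v < n, ∃ m < 3, x = 3 * v + m ∧ (v = d ∧ m ≠ l ∨ adj d v ∧ (l + m = 0 ∨ l + m = 3))

/-- The literals that are excluded after the chosen vertex gets the label `l`. -/
def extend (X : ℕ → Prop) (l : ℕ) : ℕ → Prop := fun x =>
  X x ∨ (∃ u < n, Undetermined X u) ∧ ∃ d, Chosen n adj X d ∧ Excludes n adj d l x

/-- Give the next vertex the label that is the last ternary digit of the guess. -/
def extendGuess (p : (ℕ → Prop) × ℕ) : (ℕ → Prop) × ℕ :=
  (extend n adj p.1 (p.2 % 3), p.2 / 3)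

variable {n adj}

/-- Averaging: counting pairs of a vertex and an undetermined vertex it dominates, each undetermined
vertex is dominated at least n/2 times, so not all vertices can dominate fewer than half. -/
theorem exists_chosen (X : ℕ → Prop) (hn : 0 < n)
    (hdeg : ∀ u < n, ∃ s : Finset ℕ, n ≤ 2 * s.card ∧ ∀ d ∈ s, d < n ∧ adj d u) :
    ∃ d, Chosen n adj X d := by
  classical
  have hex : ∃ d < n, numUndetermined n X ≤ 2 * cover n adj X d := by
    by_contra! hcon
    set W := (Finset.range n).filter fun u => Undetermined X u with hW
    have hsum : ∑ d ∈ Finset.range n, cover n adj X d =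
        ∑ u ∈ W, ((Finset.range n).filter fun d => u = d ∨ adj d u).card := by
      have := Finset.sum_card_bipartiteAbove_eq_sum_card_bipartiteBelow
        (s := Finset.range n) (t := W) (fun d u => u = d ∨ adj d u)
      simp only [Finset.bipartiteAbove, Finset.bipartiteBelow, hW, Finset.filter_filter] at this
      exact this
    have h1 : ∑ d ∈ Finset.range n, 2 * cover n adj X d <
        ∑ _d ∈ Finset.range n, numUndetermined n X :=
      Finset.sum_lt_sum_of_nonempty (by simpa using hn.ne')
        fun d hd => hcon d (Finset.mem_range.1 hd)
    have h2 : ∑ _u ∈ W, n ≤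
        ∑ u ∈ W, 2 * ((Finset.range n).filter fun d => u = d ∨ adj d u).card := by
      refine Finset.sum_le_sum fun u hu => ?_
      obtain ⟨s, hs, hsu⟩ := hdeg u (by simp [hW] at hu; exact hu.1)
      refine hs.trans (Nat.mul_le_mul_left _ (Finset.card_le_card fun d hd => ?_))
      simp [hsu d hd]
    rw [← Finset.mul_sum, hsum, Finset.mul_sum] at h1
    have h3 := h2.trans_lt h1
    simp only [Finset.sum_const, Finset.card_range, smul_eq_mul] at h3
    rw [numUndetermined, ← hW, mul_comm] at h3
    exact lt_irrefl _ h3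
  refine ⟨Nat.find hex, (Nat.find_spec hex).1, (Nat.find_spec hex).2, fun d' hd' h => ?_⟩
  exact Nat.find_min hex hd' ⟨hd'.trans (Nat.find_spec hex).1, h⟩

theorem Chosen.unique {X : ℕ → Prop} {d d' : ℕ} (h : Chosen n adj X d) (h' : Chosen n adj X d') :
    d = d' := by
  rcases lt_trichotomy d d' with hlt | rfl | hlt
  · exact absurd h.2.1 (h'.2.2 d hlt)
  · rfl
  · exact absurd h'.2.1 (h.2.2 d' hlt)

/-- No vertex that was undetermined and dominated by `d` stays so, since each loses a label, and
these are at least half. -/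
theorem numUndetermined_extend_le {X : ℕ → Prop} {d l : ℕ} (hd : Chosen n adj X d) (hl : l < 3)
    (hX : ∃ u < n, Undetermined X u) :
    2 * numUndetermined n (extend n adj X l) ≤ numUndetermined n X := by
  classical
  have hlt : numUndetermined n (extend n adj X l) + cover n adj X d ≤ numUndetermined n X := by
    rw [numUndetermined, cover, numUndetermined, ← Finset.card_union_of_disjoint]
    · refine Finset.card_le_card fun u hu => ?_
      simp only [Finset.mem_union, Finset.mem_filter] at hu ⊢
      rcases hu with hu | hu
      · exact ⟨hu.1, fun m hm h => hu.2 m hm (.inl h)⟩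
      · exact ⟨hu.1, hu.2.1⟩
    · rw [Finset.disjoint_left]
      intro u hu hu'
      simp only [Finset.mem_filter, Finset.mem_range] at hu hu'
      -- The vertex `d` itself loses any label other than `l`; a neighbour loses 0 if `l = 0` and `3
      -- - l` otherwise.
      obtain ⟨m, hm, h⟩ : ∃ m < 3, u = d ∧ m ≠ l ∨ adj d u ∧ (l + m = 0 ∨ l + m = 3) := by
        rcases hu'.2.2 with h | h
        · by_cases h0 : l = 0
          · exact ⟨1, by omega, .inl ⟨h, by omega⟩⟩
          · exact ⟨0, by omega, .inl ⟨h, by omega⟩⟩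
        · by_cases h0 : l = 0
          · exact ⟨0, by omega, .inr ⟨h, by omega⟩⟩
          · exact ⟨3 - l, by omega, .inr ⟨h, by omega⟩⟩
      exact hu.2 m hm (.inr ⟨hX, d, hd, u, hu.1, m, hm, rfl, h⟩)
  have := hd.2.1
  omega

/-- For every labelling, the guess that agrees with it leaves no undetermined vertex. -/
theorem exists_guess (hn : 0 < n)
    (hdeg : ∀ u < n, ∃ s : Finset ℕ, n ≤ 2 * s.card ∧ ∀ d ∈ s, d < n ∧ adj d u)
    {f : ℕ → ℕ} (hf : ∀ v < n, f v < 3)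
    (hadj : ∀ u < n, ∀ v < n, adj u v → f u + f v ≠ 0 ∧ f u + f v ≠ 3) (k : ℕ) :
    ∀ X : ℕ → Prop, (∀ v < n, ¬X (3 * v + f v)) → numUndetermined n X < 2 ^ k →
      ∃ g < 3 ^ k, ∀ i, k ≤ i → (∀ v < n, ¬((extendGuess n adj)^[i] (X, g)).1 (3 * v + f v)) ∧
        ∀ v < n, ¬Undetermined ((extendGuess n adj)^[i] (X, g)).1 v := by
  -- Once every vertex is determined, the excluded literals stay fixed whatever the rest of the
  -- guess is. So any number of iterations from `k` on works.
  have hdet : ∀ X : ℕ → Prop, (∀ v < n, ¬Undetermined X v) → ∀ i g,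
      ((extendGuess n adj)^[i] (X, g)).1 = X := by
    intro X hX i
    have hext : ∀ l, extend n adj X l = X := by
      intro l
      funext x
      refine propext ⟨?_, .inl⟩
      rintro (h | ⟨⟨u, hu, h⟩, -⟩)
      · exact h
      · exact absurd h (hX u hu)
    induction i with
    | zero => exact fun _ => rfl
    | succ i ih =>
      intro g
      rw [Function.iterate_succ_apply, extendGuess, hext]
      exact ih _
  induction k with
  | zero =>
    intro X hX hU
    have hX' : ∀ v < n, ¬Undetermined X v := by
      classical
      rw [pow_zero, Nat.lt_one_iff, numUndetermined, Finset.card_eq_zero,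
        Finset.filter_eq_empty_iff] at hU
      exact fun v hv => hU (Finset.mem_range.2 hv)
    refine ⟨0, by simp, fun i _ => ?_⟩
    rw [hdet X hX']
    exact ⟨hX, hX'⟩
  | succ k ih =>
    intro X hX hU
    by_cases hX' : ∃ u < n, Undetermined X u
    · obtain ⟨d, hd⟩ := exists_chosen (adj := adj) X hn hdeg
      have hcons : ∀ v < n, ¬extend n adj X (f d) (3 * v + f v) := by
        rintro v hv (h | ⟨-, d', hd', w, hw, m, hm, hx, h⟩)
        · exact hX v hv h
        · obtain rfl := hd'.unique hd
          have hfv := hf v hv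
          obtain rfl : v = w := by omega
          obtain rfl : f v = m := by omega
          rcases h with ⟨rfl, h⟩ | ⟨h, h'⟩
          · exact h rfl
          · have := hadj _ hd.1 _ hv h
            omega
      have hhalf : numUndetermined n (extend n adj X (f d)) < 2 ^ k := by
        have := numUndetermined_extend_le hd (hf d hd.1) hX'
        rw [pow_succ] at hU
        omega
      obtain ⟨g, hg, hgi⟩ := ih _ hcons hhalf
      have hfd := hf d hd.1
      -- The label of the vertex chosen first is the last ternary digit, the one that is read first.
      refine ⟨3 * g + f d, by rw [pow_succ]; omega, fun i hi => ?_⟩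
      obtain ⟨i, rfl⟩ : ∃ j, i = j + 1 := ⟨i - 1, by omega⟩
      have he : extendGuess n adj (X, 3 * g + f d) = (extend n adj X (f d), g) := by
        simp only [extendGuess]
        rw [show (3 * g + f d) % 3 = f d by omega, show (3 * g + f d) / 3 = g by omega]
      rw [Function.iterate_succ_apply, he]
      exact hgi i (by omega)
    · push Not at hX'
      refine ⟨0, by positivity, fun i _ => ?_⟩
      rw [hdet X hX']
      exact ⟨hX, hX'⟩

end Greedy

/-! ### Independent cuts as labellings -/

/-- The labelling `f` separates `a` from `b` by the vertices with the label `0`. -/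
def IsCutLabelling (n : ℕ) (adj : ℕ → ℕ → Prop) (a b : ℕ) (f : ℕ → ℕ) : Prop :=
  (∀ v < n, f v < 3) ∧ f a = 1 ∧ f b = 2 ∧
    ∀ u < n, ∀ v < n, adj u v → f u + f v ≠ 0 ∧ f u + f v ≠ 3

/-- Adjacency of natural numbers as vertices of `G`. -/
def natAdj {n : ℕ} (G : SimpleGraph (Fin n)) (u v : ℕ) : Prop :=
  ∃ (hu : u < n) (hv : v < n), G.Adj ⟨u, hu⟩ ⟨v, hv⟩

/-- Given a cut, side 1 is the component of `a` in the rest and side 2 is everything else outside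
the cut. Conversely, label 1 spreads along walks that avoid label 0, so it never reaches `b`. -/
theorem hasIndependentCut_iff {n : ℕ} (G : SimpleGraph (Fin n)) :
    HasIndependentCut G ↔ ∃ a < n, ∃ b < n, ∃ f, IsCutLabelling n (natAdj G) a b f := by
  classical
  constructor
  · rintro ⟨S, hS, hcut⟩
    rw [SimpleGraph.Preconnected] at hcut
    push Not at hcut
    obtain ⟨a, b, hab⟩ := hcut
    let g : Fin n → ℕ := fun v => if hv : v ∈ S then 0 else
      if (G.induce Sᶜ).Reachable a ⟨v, hv⟩ then 1 else 2
    refine ⟨a.1, a.1.2, b.1, b.1.2, fun v => if hv : v < n then g ⟨v, hv⟩ else 0, ?_, ?_, ?_, ?_⟩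
    · intro v hv
      simp only [hv, g]
      split_ifs <;> omega
    · have : (a : Fin n) ∉ S := a.2
      simp [g, this]
    · have : (b : Fin n) ∉ S := b.2
      simp [g, this, hab]
    · intro u hu v hv huv
      obtain ⟨_, _, huv⟩ := huv
      simp only [hu, hv, g, dite_true]
      by_cases h1 : (⟨u, hu⟩ : Fin n) ∈ S <;> by_cases h2 : (⟨v, hv⟩ : Fin n) ∈ S
      · exact absurd huv (hS h1 h2 huv.ne)
      · simp only [h1, h2, dite_true, dite_false]
        split_ifs <;> omega
      · simp only [h1, h2, dite_true, dite_false]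
        split_ifs <;> omega
      · have hadj : (G.induce Sᶜ).Adj ⟨⟨u, hu⟩, h1⟩ ⟨⟨v, hv⟩, h2⟩ := huv
        have hiff : (G.induce Sᶜ).Reachable a ⟨⟨u, hu⟩, h1⟩ ↔
            (G.induce Sᶜ).Reachable a ⟨⟨v, hv⟩, h2⟩ :=
          ⟨fun h => h.trans hadj.reachable, fun h => h.trans hadj.symm.reachable⟩
        simp only [h1, h2, dite_false, hiff]
        split_ifs <;> omega
  · rintro ⟨a, ha, b, hb, f, hf, hfa, hfb, hadj⟩
    refine ⟨{v | f v = 0}, ?_, ?_⟩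
    · intro u hu v hv _ huv
      have := hadj u u.2 v v.2 ⟨u.2, v.2, huv⟩
      simp only [Set.mem_ofPred_eq] at hu hv
      omega
    · intro hcon
      have ha0 : (⟨a, ha⟩ : Fin n) ∈ ({v : Fin n | f v = 0} : Set (Fin n))ᶜ := by simp [hfa]
      have hb0 : (⟨b, hb⟩ : Fin n) ∈ ({v : Fin n | f v = 0} : Set (Fin n))ᶜ := by simp [hfb]
      obtain ⟨p⟩ := hcon ⟨_, ha0⟩ ⟨_, hb0⟩
      have key : ∀ (x y : ({v : Fin n | f v = 0} : Set (Fin n))ᶜ.Elem),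
          (G.induce ({v : Fin n | f v = 0} : Set (Fin n))ᶜ).Walk x y →
          f x.1 = 1 → f y.1 = 1 := by
        intro x y p
        induction p with
        | nil => exact id
        | @cons x y z hxy _ ih =>
          intro hx
          refine ih ?_
          have h1 := hadj x.1 x.1.2 y.1 y.1.2 ⟨x.1.2, y.1.2, hxy⟩
          have h2 := hf y.1 y.1.2
          have h3 : f y.1 ≠ 0 := y.2
          omega
      have := key _ _ p hfa
      simp only at this
      omega

/-! ### Correctness of the method -/

/-- The initial clashes between literals, for excluded literals `X` and sides `a` and `b`. -/
def Clash (n : ℕ) (adj : ℕ → ℕ → Prop) (a b : ℕ) (X : ℕ → Prop) (x y : ℕ) : Prop :=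
  let out : ℕ → Prop := fun x => X x ∨ x = 3 * a ∨ x = 3 * a + 2 ∨ x = 3 * b ∨ x = 3 * b + 1
  out x ∨ out y ∨ ∃ u < n, ∃ v < n, adj u v ∧ ∃ l < 3, ∃ m < 3,
    (l + m = 0 ∨ l + m = 3) ∧ x = 3 * u + l ∧ y = 3 * v + m

/-- One step of elimination. -/
def eliminate (k : ℕ) (F : ℕ → ℕ → Prop) (x y : ℕ) : Prop :=
  F x y ∨ ∀ l < 3, F (3 * k + l) x ∨ F (3 * k + l) y

/-- The clashes after `k` steps of elimination. -/
def clashes (n : ℕ) (adj : ℕ → ℕ → Prop) (a b : ℕ) (X : ℕ → Prop) : ℕ → ℕ → ℕ → Prop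
  | 0 => Clash n adj a b X
  | k + 1 => eliminate k (clashes n adj a b X k)

/-- The guess `g` and the vertices `a`, `b` are accepted. -/
def Accepts (n : ℕ) (adj : ℕ → ℕ → Prop) (g a b : ℕ) : Prop :=
  a < n ∧ b < n ∧
    (∀ v < n, ¬Undetermined ((extendGuess n adj)^[n] (fun _ => False, g)).1 v) ∧
    ¬clashes n adj a b ((extendGuess n adj)^[n] (fun _ => False, g)).1 n (3 * n) (3 * n)

section Correctness

variable {n : ℕ} {adj : ℕ → ℕ → Prop} {g a b : ℕ}

/-- Needed so that the constant literal `3 * n` is never excluded. -/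
theorem lt_of_extendGuess (g : ℕ) (X : ℕ → Prop) (hX : ∀ x, X x → x < 3 * n) (i : ℕ) :
    ∀ x, ((extendGuess n adj)^[i] (X, g)).1 x → x < 3 * n := by
  induction i with
  | zero => exact hX
  | succ i ih =>
    intro x
    rw [Function.iterate_succ_apply']
    rintro (h | ⟨-, d, -, v, hv, m, hm, rfl, -⟩)
    · exact ih x h
    · omega

/-- Soundness. Acceptance itself checks that every vertex has lost a label, which is all that
elimination needs, so no domination argument is involved. -/
theorem Accepts.exists_isCutLabelling (hirr : ∀ u, ¬adj u u) (hsymm : ∀ u v, adj u v → adj v u)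
    (h : Accepts n adj g a b) : ∃ f, IsCutLabelling n adj a b f := by
  obtain ⟨ha, hb, hdet, hend⟩ := h
  set X := ((extendGuess n adj)^[n] (fun _ => False, g)).1
  have hsym : ∀ x ≤ 3 * n, ∀ y ≤ 3 * n, Clash n adj a b X x y → Clash n adj a b X y x := by
    rintro x - y - (h | h | ⟨u, hu, v, hv, huv, l, hl, m, hm, hlm, hx, hy⟩)
    · exact .inr (.inl h)
    · exact .inl h
    · exact .inr (.inr ⟨v, hv, u, hu, hsymm u v huv, m, hm, l, hl, by omega, hy, hx⟩)
  -- A self-clash can come only from an excluded literal: one arising from an edge would make a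
  -- vertex adjacent to itself.
  have hdiag : ∀ x ≤ 3 * n, ∀ y ≤ 3 * n, Clash n adj a b X x x → Clash n adj a b X x y := by
    rintro x - y - (h | h | ⟨u, hu, v, hv, huv, l, hl, m, hm, hlm, hx, hy⟩)
    · exact .inl h
    · exact .inl h
    · obtain rfl : u = v := by omega
      exact absurd huv (hirr u)
  have hlist : ∀ v < n, ∃ l < 3, ∀ y ≤ 3 * n, Clash n adj a b X (3 * v + l) y := by
    intro v hv
    have := hdet v hv
    simp only [Undetermined, not_forall, not_not] at this
    obtain ⟨l, hl, h⟩ := this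
    exact ⟨l, hl, fun y _ => .inl (.inl h)⟩
  obtain ⟨f, hf, hF⟩ := exists_labelling_of_elimination (F := clashes n adj a b X)
    (fun k _ x _ y _ => Iff.rfl) hsym hdiag hlist hend
  have hlit : ∀ v < n, IsTrueLit n f (3 * v + f v) := fun v hv => .inr ⟨v, hv, rfl⟩
  have ha' := hF _ _ (hlit a ha) (hlit a ha)
  have hb' := hF _ _ (hlit b hb) (hlit b hb)
  have hfa := hf a ha
  have hfb := hf b hb
  refine ⟨f, hf, ?_, ?_, fun u hu v hv huv => ?_⟩
  · by_contra hne
    exact ha' (.inl (.inr (by omega)))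
  · by_contra hne
    exact hb' (.inl (.inr (by omega)))
  · by_contra hne
    exact hF _ _ (hlit u hu) (hlit v hv) (.inr (.inr ⟨u, hu, v, hv, huv, f u, hf u hu, f v,
      hf v hv, by omega, rfl, rfl⟩))

/-- Completeness. The guess that reads its digits off the given labelling excludes no true literal,
so that labelling certifies that elimination derives no contradiction. -/
theorem IsCutLabelling.exists_accepts (hn : 0 < n)
    (hdeg : ∀ u < n, ∃ s : Finset ℕ, n ≤ 2 * s.card ∧ ∀ d ∈ s, d < n ∧ adj d u)
    (ha : a < n) (hb : b < n) {f : ℕ → ℕ} (h : IsCutLabelling n adj a b f) :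
    ∃ g < 4 * n ^ 2, Accepts n adj g a b := by
  classical
  obtain ⟨hf, hfa, hfb, hadj⟩ := h
  -- The binary length of `n` is the number of halvings that leave nothing undetermined; it is at
  -- most `n`, the number of iterations performed.
  obtain ⟨g, hg, hgi⟩ := exists_guess hn hdeg hf hadj n.size (fun _ => False) (by simp)
    ((Finset.card_filter_le _ _).trans_lt (by simpa using Nat.lt_size_self n))
  obtain ⟨hX, hdet⟩ := hgi n (Nat.size_le.2 Nat.lt_two_pow_self)
  refine ⟨g, hg.trans_le ?_, ha, hb, hdet,
    not_clash_of_elimination (fun k _ x _ y _ => Iff.rfl) hf ?_⟩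
  · have h1 : 2 ^ n.size ≤ 2 * n := by
      have h2 : 2 ^ (n.size - 1) ≤ n := Nat.lt_size.1 (by have := Nat.size_pos.2 hn; omega)
      have h3 : n.size = n.size - 1 + 1 := by have := Nat.size_pos.2 hn; omega
      rw [h3, pow_succ]
      omega
    calc 3 ^ n.size ≤ 4 ^ n.size := Nat.pow_le_pow_left (by omega) _
      _ = (2 ^ n.size) ^ 2 := by rw [← pow_mul, mul_comm, pow_mul]; norm_num
      _ ≤ (2 * n) ^ 2 := Nat.pow_le_pow_left h1 2
      _ = 4 * n ^ 2 := by ring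
  · set X := ((extendGuess n adj)^[n] (fun _ => False, g)).1
    have hout : ∀ x, IsTrueLit n f x →
        ¬(X x ∨ x = 3 * a ∨ x = 3 * a + 2 ∨ x = 3 * b ∨ x = 3 * b + 1) := by
      rintro x (rfl | ⟨v, hv, rfl⟩)
      · have := fun h => lt_of_extendGuess (n := n) (adj := adj) g (fun _ => False) (by simp) n (3 * n) h
        rintro (h | h)
        · exact lt_irrefl _ (this h)
        · omega
      · have hfv := hf v hv
        rintro (h | h)
        · exact hX v hv h
        · by_cases hva : v = a
          · subst hva
            by_cases hvb : v = b
            · subst hvb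
              omega
            · omega
          · by_cases hvb : v = b
            · subst hvb
              omega
            · omega
    rintro x y hx hy (h | h | ⟨u, hu, v, hv, huv, l, hl, m, hm, hlm, rfl, rfl⟩)
    · exact hout x hx h
    · exact hout y hy h
    · have hlab : ∀ w m, w < n → m < 3 → IsTrueLit n f (3 * w + m) → f w = m := by
        rintro w m hw hm (h | ⟨w', hw', h⟩)
        · omega
        · have := hf w' hw'
          obtain rfl : w = w' := by omega
          omega
      have := hadj u hu v hv huv
      rw [hlab u l hu hl hx, hlab v m hv hm hy] at this
      omega

end Correctness

namespace RAM

/-! ### Conditions as expressions -/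

namespace Expr

/-- The expression, read as a condition, holds. -/
def Holds (M : ℕ) (σ : ℕ → ℕ → ℕ → ℕ) (e : Expr) (env : ℕ → ℕ) : Prop := e.eval M σ env ≠ 0

/-- `a < b` -/
def lt (a b : Expr) : Expr := .sub b a

/-- `a ≤ b` -/
def le (a b : Expr) : Expr := .sub (.lit 1) (.sub a b)

/-- `a = b` -/
def eq (a b : Expr) : Expr := .sub (.lit 1) (.add (.sub a b) (.sub b a))

/-- negation -/
def not (a : Expr) : Expr := .sub (.lit 1) a

/-- conjunction -/
def and (a b : Expr) : Expr := .ite a b (.lit 0)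

/-- disjunction -/
def or (a b : Expr) : Expr := .add a b

/-- existential quantifier -/
def ex (i : ℕ) (a : Expr) : Expr := .sum i a

/-- universal quantifier -/
def all (i : ℕ) (a : Expr) : Expr := not (ex i (not a))

/-- the number of values for which a condition holds -/
def count (i : ℕ) (a : Expr) : Expr := .sum i (.ite a (.lit 1) (.lit 0))

/-- `3 * a + b` -/
def lit3 (a b : Expr) : Expr := .add (.add (.add a a) a) b

section

variable {M : ℕ} {σ : ℕ → ℕ → ℕ → ℕ} {env : ℕ → ℕ} (a b : Expr) (i : ℕ)

@[simp] theorem eval_lit (c : ℕ) : (Expr.lit c).eval M σ env = c := rfl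

@[simp] theorem eval_var : (Expr.var i).eval M σ env = env i := rfl

@[simp] theorem eval_add : (Expr.add a b).eval M σ env = a.eval M σ env + b.eval M σ env := rfl

@[simp] theorem eval_load (x y : Expr) : (Expr.load a x y).eval M σ env =
    σ (a.eval M σ env) (x.eval M σ env) (y.eval M σ env) := rfl

@[simp] theorem eval_lit3 :
    (lit3 a b).eval M σ env = 3 * a.eval M σ env + b.eval M σ env := by
  simp only [lit3, Expr.eval]
  ring

theorem eval_ite (c : Expr) [Decidable (c.Holds M σ env)] : (Expr.ite c a b).eval M σ env =
    if c.Holds M σ env then a.eval M σ env else b.eval M σ env := by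
  rw [Expr.eval]
  congr

open Classical in
theorem eval_count : (count i a).eval M σ env =
    ((Finset.range M).filter fun t => a.Holds M σ (Function.update env i t)).card := by
  simp only [count, Expr.eval, Finset.card_filter]
  refine Finset.sum_congr rfl fun t _ => ?_
  simp only [Holds]
  congr

-- Comparisons rest on truncated subtraction: `b - a` is nonzero exactly when `a < b`, and
-- subtracting from 1 negates a condition.
@[simp] theorem holds_lt : (lt a b).Holds M σ env ↔ a.eval M σ env < b.eval M σ env := by
  simp only [Holds, lt, Expr.eval]
  omega

@[simp] theorem holds_le : (le a b).Holds M σ env ↔ a.eval M σ env ≤ b.eval M σ env := by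
  simp only [Holds, le, Expr.eval]
  omega

@[simp] theorem holds_eq : (eq a b).Holds M σ env ↔ a.eval M σ env = b.eval M σ env := by
  simp only [Holds, eq, Expr.eval]
  omega

@[simp] theorem holds_not : (not a).Holds M σ env ↔ ¬a.Holds M σ env := by
  simp only [Holds, not, Expr.eval]
  omega

@[simp] theorem holds_and : (and a b).Holds M σ env ↔ a.Holds M σ env ∧ b.Holds M σ env := by
  simp only [Holds, and, Expr.eval]
  split_ifs <;> simp_all

@[simp] theorem holds_or : (or a b).Holds M σ env ↔ a.Holds M σ env ∨ b.Holds M σ env := by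
  simp only [Holds, or, Expr.eval]
  omega

@[simp] theorem holds_ex :
    (ex i a).Holds M σ env ↔ ∃ t < M, a.Holds M σ (Function.update env i t) := by
  simp [Holds, ex, Expr.eval, Finset.sum_eq_zero_iff]

@[simp] theorem holds_all :
    (all i a).Holds M σ env ↔ ∀ t < M, a.Holds M σ (Function.update env i t) := by
  simp [all]

@[simp] theorem holds_load (x y : Expr) : (Expr.load a x y).Holds M σ env ↔
    σ (a.eval M σ env) (x.eval M σ env) (y.eval M σ env) ≠ 0 := Iff.rfl

end

/-! ### The expressions of the algorithm

The variable `0` holds the order `n` of the graph, the variables `1`, `2`, `3` hold the guess and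
the two separated vertices, the variable `4` counts steps, and the variables `5` and `6` are the
indices of the entry to be computed. -/

/-- adjacency of the vertices in the variables `u` and `v` -/
def adj (u v : ℕ) : Expr :=
  and (lt (.var u) (.var 0)) <| and (lt (.var v) (.var 0)) <|
    .load (.lit 0) (.lit 0)
      (.add (.sum 20 (.ite (lt (.var 20) (.var 0)) (.var u) (.lit 0))) (.var v))

/-- the labels in the variables `l` and `m` may not be given to adjacent vertices -/
def conflict (l m : ℕ) : Expr :=
  or (eq (.add (.var l) (.var m)) (.lit 0)) (eq (.add (.var l) (.var m)) (.lit 3))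

/-- no label of the vertex in the variable `u` is excluded by row `0` of the array `A` -/
def undetermined (A : Expr) (u : ℕ) : Expr :=
  all 19 (or (not (lt (.var 19) (.lit 3))) (not (.load A (.lit 0) (lit3 (.var u) (.var 19)))))

/-- the number of undetermined vertices -/
def numUndetermined (A : Expr) : Expr :=
  count 18 (and (lt (.var 18) (.var 0)) (undetermined A 18))

/-- the number of undetermined vertices dominated by the vertex in the variable `d` -/
def cover (A : Expr) (d : ℕ) : Expr :=
  count 18 (and (lt (.var 18) (.var 0)) (and (undetermined A 18)
    (or (eq (.var 18) (.var d)) (adj d 18))))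

/-- the vertex in the variable `d` dominates half of the undetermined vertices -/
def coversHalf (A : Expr) (d : ℕ) : Expr :=
  le (numUndetermined A) (.add (cover A d) (cover A d))

/-- the vertex in the variable `d` is the one to be labelled next -/
def chosen (A : Expr) (d : ℕ) : Expr :=
  and (lt (.var d) (.var 0)) <| and (coversHalf A d) <|
    all 17 (or (not (lt (.var 17) (.var d))) (not (coversHalf A 17)))

/-- the literal `x` is excluded by giving the label `l` to the vertex `d` -/
def excludes (d l x : ℕ) : Expr :=
  ex 15 <| and (lt (.var 15) (.var 0)) <| ex 16 <| and (lt (.var 16) (.lit 3)) <|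
    and (eq (.var x) (lit3 (.var 15) (.var 16))) <|
    or (and (eq (.var 15) (.var d)) (not (eq (.var 16) (.var l))))
      (and (adj d 15) (conflict l 16))

/-- the array of excluded literals at the current step -/
def current : Expr := .add (.add (.var 4) (.var 4)) (.lit 2)

/-- the next array of excluded literals (row `0`) and the rest of the guess (row `1`) -/
def extend : Expr :=
  .ite (eq (.var 5) (.lit 0))
    (or (.load current (.lit 0) (.var 6)) <|
      and (ex 10 (and (lt (.var 10) (.var 0)) (undetermined current 10))) <|
      ex 10 <| and (chosen current 10) <| ex 11 <| and (lt (.var 11) (.lit 3)) <|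
      and (ex 12 (eq (.load current (.lit 1) (.lit 0)) (lit3 (.var 12) (.var 11))))
        (excludes 10 11 6))
    (.sum 12 (.ite (ex 11 (and (lt (.var 11) (.lit 3))
      (eq (.load current (.lit 1) (.lit 0)) (lit3 (.var 12) (.var 11))))) (.var 12) (.lit 0)))

/-- the array of excluded literals after all steps -/
def final : Expr := .add (.add (.var 0) (.var 0)) (.lit 2)

/-- the literal in the variable `x` is excluded -/
def out (x : ℕ) : Expr :=
  or (.load final (.lit 0) (.var x)) <| or (eq (.var x) (lit3 (.var 2) (.lit 0))) <|
  or (eq (.var x) (lit3 (.var 2) (.lit 2))) <| or (eq (.var x) (lit3 (.var 3) (.lit 0)))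
    (eq (.var x) (lit3 (.var 3) (.lit 1)))

/-- the literals in the variables `5` and `6` clash -/
def clash : Expr :=
  or (out 5) <| or (out 6) <| ex 10 <| ex 11 <| and (adj 10 11) <|
  ex 12 <| and (lt (.var 12) (.lit 3)) <| ex 13 <| and (lt (.var 13) (.lit 3)) <|
  and (conflict 12 13) <| and (eq (.var 5) (lit3 (.var 10) (.var 12)))
    (eq (.var 6) (lit3 (.var 11) (.var 13)))

/-- the literals in the variables `5` and `6` clash after the next elimination -/
def eliminate : Expr :=
  let A : Expr := .add (.add (.var 4) (.var 4)) (.lit 3)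
  or (.load A (.var 5) (.var 6)) <| all 10 <| or (not (lt (.var 10) (.lit 3))) <|
    or (.load A (lit3 (.var 4) (.var 10)) (.var 5)) (.load A (lit3 (.var 4) (.var 10)) (.var 6))

/-- the guess is accepted -/
def accepts : Expr :=
  and (lt (.var 2) (.var 0)) <| and (lt (.var 3) (.var 0)) <|
  and (all 10 (or (not (lt (.var 10) (.var 0))) (not (undetermined final 10)))) <|
  not (.load (.add (.add (.var 0) (.var 0)) (.lit 3)) (lit3 (.var 0) (.lit 0))
    (lit3 (.var 0) (.lit 0)))

/-- `σ` holds the adjacency matrix of `adj`. -/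
def IsInput (n : ℕ) (R : ℕ → ℕ → Prop) (σ : ℕ → ℕ → ℕ → ℕ) : Prop :=
  ∀ u v, R u v ↔ u < n ∧ v < n ∧ σ 0 0 (n * u + v) ≠ 0

section

variable {n M : ℕ} {σ : ℕ → ℕ → ℕ → ℕ} {env : ℕ → ℕ} {R : ℕ → ℕ → Prop}

/-- The product `n * u` is formed by adding `u` for each of the `n` values of variable 20 below `n`;
the condition on `u` prevents its capture by that sum. -/
theorem holds_adj (hR : IsInput n R σ) (hM : n ≤ M) (hn : env 0 = n) {u v : ℕ}
    (hu : u ≠ 20) : (adj u v).Holds M σ env ↔ R (env u) (env v) := by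
  classical
  have hs : (Expr.sum 20 (.ite (lt (.var 20) (.var 0)) (.var u) (.lit 0))).eval M σ env =
      n * env u := by
    rw [Expr.eval]
    simp only [eval_ite, holds_lt, eval_var, eval_lit, Function.update_apply, if_neg hu, hn]
    simp only [if_true, OfNat.zero_ne_ofNat, if_false]
    rw [← Finset.sum_filter, Finset.sum_const, smul_eq_mul]
    congr 1
    rw [show (Finset.range M).filter (fun t => t < n) = Finset.range n by ext t; simp; omega,
      Finset.card_range]
  rw [hR, adj, holds_and, holds_and, holds_lt, holds_lt, holds_load, eval_add, hs]
  simp [hn]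

theorem holds_conflict {l m : ℕ} :
    (conflict l m).Holds M σ env ↔ env l + env m = 0 ∨ env l + env m = 3 := by
  simp [conflict]

theorem holds_undetermined (hM : 3 ≤ M) {A : Expr} {i u : ℕ}
    (hA : ∀ t, A.eval M σ (Function.update env 19 t) = i) (hu : u ≠ 19) :
    (undetermined A u).Holds M σ env ↔ Undetermined (fun x => σ i 0 x ≠ 0) (env u) := by
  simp only [undetermined, holds_all, holds_or, holds_not, holds_lt, holds_load, eval_lit3,
    eval_var, eval_lit, hA, Function.update_apply, if_neg hu, if_true, Undetermined, not_lt]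
  exact ⟨fun h l hl => (h l (by omega)).resolve_left (by omega), fun h l _ => by
    by_cases hl : l < 3
    · exact .inr (h l hl)
    · exact .inl (by omega)⟩

/-- The expression does not depend on local variables. -/
def Stable (M : ℕ) (σ : ℕ → ℕ → ℕ → ℕ) (A : Expr) (env : ℕ → ℕ) (i : ℕ) : Prop :=
  ∀ env', (∀ j < 10, env' j = env j) → A.eval M σ env' = i

/-- Bound variables are numbered from 10 on, so quantifiers do not disturb array indices built from
the lower variables. -/
theorem Stable.update {A : Expr} {i j : ℕ} (h : A.Stable M σ env i) (hj : 10 ≤ j) (t : ℕ) :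
    A.Stable M σ (Function.update env j t) i := fun env' h' =>
  h env' fun k hk => by rw [h' k hk, Function.update_of_ne (by omega)]

theorem Stable.holds_undetermined {A : Expr} {i u : ℕ} (h : A.Stable M σ env i) (hM : 3 ≤ M)
    (hu : u ≠ 19) :
    (undetermined A u).Holds M σ env ↔ Undetermined (fun x => σ i 0 x ≠ 0) (env u) :=
  Expr.holds_undetermined hM (fun t => h _ fun j hj => Function.update_of_ne (by omega) _ _) hu

theorem Stable.eval_numUndetermined {A : Expr} {i : ℕ} (h : A.Stable M σ env i) (hM : 3 ≤ M)
    (hnM : n ≤ M) (hn : env 0 = n) :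
    (numUndetermined A).eval M σ env = _root_.numUndetermined n fun x => σ i 0 x ≠ 0 := by
  classical
  rw [numUndetermined, eval_count, _root_.numUndetermined]
  congr 1
  ext t
  simp only [Finset.mem_filter, Finset.mem_range, holds_and, holds_lt,
    (h.update (show 10 ≤ 18 by omega) t).holds_undetermined hM (show 18 ≠ 19 by omega)]
  simp [hn]
  omega

theorem Stable.eval_cover {A : Expr} {i d : ℕ} (h : A.Stable M σ env i) (hM : 3 ≤ M)
    (hnM : n ≤ M) (hn : env 0 = n) (hR : IsInput n R σ) (hd : d ≠ 18) (hd' : d ≠ 20) :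
    (cover A d).eval M σ env = _root_.cover n R (fun x => σ i 0 x ≠ 0) (env d) := by
  classical
  rw [cover, eval_count, _root_.cover]
  congr 1
  ext t
  simp only [Finset.mem_filter, Finset.mem_range, holds_and, holds_lt, holds_or, holds_eq,
    (h.update (show 10 ≤ 18 by omega) t).holds_undetermined hM (show 18 ≠ 19 by omega),
    holds_adj (env := Function.update env 18 t) hR hnM (by simp [hn]) hd']
  simp [hn, hd]
  omega

theorem Stable.holds_chosen {A : Expr} {i d : ℕ} (h : A.Stable M σ env i) (hM : 3 ≤ M)
    (hnM : n ≤ M) (hn : env 0 = n) (hR : IsInput n R σ) (hd : d ≠ 17) (hd' : d ≠ 18)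
    (hd'' : d ≠ 20) :
    (chosen A d).Holds M σ env ↔ Chosen n R (fun x => σ i 0 x ≠ 0) (env d) := by
  have h17 := fun t => h.update (show 10 ≤ 17 by omega) t
  have hn17 : ∀ t, Function.update env 17 t 0 = n := by simp [hn]
  simp only [chosen, coversHalf, holds_and, holds_lt, holds_all, holds_or, holds_not, holds_le,
    eval_add, h.eval_numUndetermined hM hnM hn, h.eval_cover hM hnM hn hR hd' hd'',
    fun t => (h17 t).eval_numUndetermined hM hnM (hn17 t),
    fun t => (h17 t).eval_cover hM hnM (hn17 t) hR (show 17 ≠ 18 by omega)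
      (show 17 ≠ 20 by omega)]
  simp only [eval_var, Function.update_apply, if_neg hd, if_true, hn, Chosen, ← two_mul]
  refine and_congr_right fun h1 => and_congr_right fun _ => ?_
  exact ⟨fun h t ht => (h t (by omega)).resolve_left (by omega),
    fun h t _ => by
      by_cases ht : t < env d
      · exact .inr (h t ht)
      · exact .inl ht⟩

theorem holds_excludes (hM : 3 ≤ M) (hnM : n ≤ M) (hn : env 0 = n) (hR : IsInput n R σ)
    {d l x : ℕ} (hd : d < 15) (hl : l < 15) (hx : x < 15) :
    (excludes d l x).Holds M σ env ↔ Excludes n R (env d) (env l) (env x) := by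
  have hn16 : ∀ s t, Function.update (Function.update env 15 s) 16 t 0 = n := by simp [hn]
  simp only [excludes, holds_ex, holds_and, holds_lt, holds_eq, holds_or, holds_not,
    holds_conflict, fun s t => holds_adj (env := Function.update (Function.update env 15 s) 16 t)
      hR hnM (hn16 s t) (v := 15) (show d ≠ 20 by omega)]
  simp only [eval_lit3, eval_var, eval_lit, Function.update_apply,
    if_neg (show d ≠ 15 by omega), if_neg (show d ≠ 16 by omega), if_neg (show l ≠ 15 by omega),
    if_neg (show l ≠ 16 by omega), if_neg (show x ≠ 15 by omega), if_neg (show x ≠ 16 by omega)]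
  simp only [OfNat.zero_ne_ofNat, if_true, if_false, hn, Excludes, Nat.reduceEqDiff]
  constructor
  · rintro ⟨v, -, hv, m, -, hm, h⟩
    exact ⟨v, hv, m, hm, h⟩
  · rintro ⟨v, hv, m, hm, h⟩
    exact ⟨v, by omega, hv, m, by omega, hm, h⟩

end

end Expr

end RAM

/-! ### Dependence on the literals below the size bound -/

section Congr

variable {n M : ℕ} {adj : ℕ → ℕ → Prop} {X Y : ℕ → Prop}

theorem undetermined_congr (h : ∀ x < M, X x ↔ Y x) (hM : 3 * n ≤ M) {u : ℕ} (hu : u < n) :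
    Undetermined X u ↔ Undetermined Y u :=
  forall₂_congr fun l hl => not_congr (h _ (by omega))

theorem chosen_congr (h : ∀ x < M, X x ↔ Y x) (hM : 3 * n ≤ M) (d : ℕ) :
    Chosen n adj X d ↔ Chosen n adj Y d := by
  classical
  have h1 : numUndetermined n X = numUndetermined n Y := by
    rw [numUndetermined, numUndetermined]
    congr 1
    exact Finset.filter_congr fun u hu => undetermined_congr h hM (Finset.mem_range.1 hu)
  have h2 : ∀ d, cover n adj X d = cover n adj Y d := by
    intro d
    rw [cover, cover]
    congr 1
    exact Finset.filter_congr fun u hu =>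
      and_congr_left fun _ => undetermined_congr h hM (Finset.mem_range.1 hu)
  simp only [Chosen, h1, h2]

/-- An array row stores a set of literals only below `M`. Every vertex has its literals there, so
the greedy step cannot see the difference. -/
theorem extend_congr (h : ∀ x < M, X x ↔ Y x) (hM : 3 * n ≤ M) (l : ℕ) {x : ℕ} (hx : x < M) :
    extend n adj X l x ↔ extend n adj Y l x := by
  simp only [extend, h x hx, chosen_congr h hM]
  refine or_congr_right (and_congr_left fun _ => exists_congr fun u => ?_)
  exact and_congr_right fun hu => undetermined_congr h hM hu

end Congr

/-! ### Filling, iterating and searching with loops -/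

namespace RAM

namespace Cmd

/-- Compute all entries of the array `A` by the expression `e`. -/
def fill (A e : Expr) : Cmd := .loop 5 (.loop 6 (.store A (.var 5) (.var 6) e))

/-- Compute the arrays `c + 2`, `c + 4`, … one from the other by the expression `e`. -/
def iterate (c : ℕ) (e : Expr) : Cmd :=
  .loop 4 (fill (.add (.add (.var 4) (.var 4)) (.lit (c + 2))) e)

variable {M : ℕ} {σ : ℕ → ℕ → ℕ → ℕ} {env : ℕ → ℕ}

/-- An invariant of a loop. -/
theorem run_loop {i : ℕ} {c : Cmd} (I : ℕ → (ℕ → ℕ → ℕ → ℕ) → Prop) (h0 : I 0 σ)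
    (hstep : ∀ t < M, ∀ τ, I t τ → I (t + 1) (c.run M (Function.update env i t) τ)) :
    I M ((Cmd.loop i c).run M env σ) := by
  have key : ∀ m ≤ M, I m (Nat.rec σ (fun t τ => c.run M (Function.update env i t) τ) m) := by
    intro m
    induction m with
    | zero => exact fun _ => h0
    | succ m ih => exact fun hm => hstep m (by omega) _ (ih (by omega))
  exact key M le_rfl

/-- The value of `e` has to satisfy `Q` for any contents of the array being written; hence the
half-filled array never matters. -/
theorem run_fill {A e : Expr} {a : ℕ} {Q : ℕ → ℕ → ℕ → Prop}
    (hA : ∀ x y τ, A.eval M τ (Function.update (Function.update env 5 x) 6 y) = a)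
    (hQ : ∀ x < M, ∀ y < M, ∀ τ, (∀ a', a' ≠ a → τ a' = σ a') →
      Q x y (e.eval M τ (Function.update (Function.update env 5 x) 6 y))) :
    (∀ a', a' ≠ a → (fill A e).run M env σ a' = σ a') ∧
      ∀ x < M, ∀ y < M, Q x y ((fill A e).run M env σ a x y) := by
  have key := run_loop (M := M) (σ := σ) (env := env) (i := 5)
    (c := .loop 6 (.store A (.var 5) (.var 6) e))
    (fun t τ => (∀ a', a' ≠ a → τ a' = σ a') ∧ ∀ x < t, ∀ y < M, Q x y (τ a x y))
    ⟨fun _ _ => rfl, fun x hx => absurd hx (Nat.not_lt_zero x)⟩ ?_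
  · exact key
  rintro x hx τ ⟨hτ, hQτ⟩
  have key' := run_loop (M := M) (σ := τ) (env := Function.update env 5 x) (i := 6)
    (c := .store A (.var 5) (.var 6) e)
    (fun t ρ => (∀ a', a' ≠ a → ρ a' = σ a') ∧ (∀ x' < x, ∀ y < M, Q x' y (ρ a x' y)) ∧
      ∀ y < t, Q x y (ρ a x y))
    ⟨hτ, hQτ, fun y hy => absurd hy (Nat.not_lt_zero y)⟩ ?_
  · refine ⟨key'.1, fun x' hx' y hy => ?_⟩
    obtain h | rfl : x' < x ∨ x' = x := by omega
    · exact key'.2.1 x' h y hy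
    · exact key'.2.2 y hy
  rintro y hy ρ ⟨hρ, hQρ, hQρ'⟩
  have h6 : Function.update (Function.update env 5 x) 6 y 5 = x := by simp
  have h6' : Function.update (Function.update env 5 x) 6 y 6 = y := by simp
  simp only [Cmd.run, hA, Expr.eval_var, h6, h6']
  refine ⟨fun a' ha' => ?_, fun x' hx' y' hy' => ?_, fun y' hy' => ?_⟩
  · rw [← hρ a' ha']
    funext x' y'
    rw [write, if_neg fun h => ha' h.1]
  · rw [write, if_neg fun h => by omega]
    exact hQρ x' hx' y' hy'
  · rw [write]
    split_ifs with h
    · rw [h.2.2.1]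
      exact hQ x hx y hy ρ hρ
    · exact hQρ' y' (by omega)

/-- Each stage has its own array, and the stride 2 lets the families for `c = 2` and `c = 3`
interleave without overlap, away from array 0. -/
theorem run_iterate {c : ℕ} {e : Expr} {P : ℕ → ℕ → ℕ → ℕ → Prop}
    (h0 : ∀ x < M, ∀ y < M, P 0 x y (σ c x y))
    (hstep : ∀ t < M, ∀ τ, (∀ a', (∀ s, a' ≠ 2 * s + c + 2) → τ a' = σ a') →
      (∀ x < M, ∀ y < M, P t x y (τ (2 * t + c) x y)) → ∀ x < M, ∀ y < M, P (t + 1) x y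
        (e.eval M τ (Function.update (Function.update (Function.update env 4 t) 5 x) 6 y))) :
    (∀ a', (∀ s, a' ≠ 2 * s + c + 2) → (iterate c e).run M env σ a' = σ a') ∧
      ∀ t ≤ M, ∀ x < M, ∀ y < M, P t x y ((iterate c e).run M env σ (2 * t + c) x y) := by
  have key := run_loop (M := M) (σ := σ) (env := env) (i := 4)
    (c := fill (.add (.add (.var 4) (.var 4)) (.lit (c + 2))) e)
    (fun t τ => (∀ a', (∀ s, a' ≠ 2 * s + c + 2) → τ a' = σ a') ∧
      ∀ s ≤ t, ∀ x < M, ∀ y < M, P s x y (τ (2 * s + c) x y)) ?_ ?_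
  · exact key
  · refine ⟨fun _ _ => rfl, fun s hs => ?_⟩
    obtain rfl : s = 0 := by omega
    simpa using h0
  · rintro t ht τ ⟨hτ, hP⟩
    have hfill := run_fill (M := M) (σ := τ) (env := Function.update env 4 t)
      (A := .add (.add (.var 4) (.var 4)) (.lit (c + 2))) (e := e) (a := 2 * t + c + 2)
      (Q := P (t + 1)) (fun x y τ' => by simp; omega) (fun x hx y hy τ' hτ' => ?_)
    · obtain ⟨h1, h2⟩ := hfill
      refine ⟨fun a' ha' => by rw [h1 a' (ha' t), hτ a' ha'], fun s hs => ?_⟩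
      obtain h | rfl : s ≤ t ∨ s = t + 1 := by omega
      · rw [h1 _ (by omega)]
        exact hP s h
      · rw [show 2 * (t + 1) + c = 2 * t + c + 2 by ring]
        exact h2
    · refine hstep t ht τ' (fun a' ha' => by rw [hτ' a' (ha' t), hτ a' ha']) ?_ x hx y hy
      rw [hτ' _ (by omega)]
      exact hP t le_rfl

/-- Loops over all values of a variable search for a value that sets a flag. -/
theorem run_loop_flag {i : ℕ} {c : Cmd} {B : ℕ → Prop}
    (h : ∀ t < M, ∀ τ : ℕ → ℕ → ℕ → ℕ, τ 0 0 = σ 0 0 →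
      c.run M (Function.update env i t) τ 0 0 = σ 0 0 ∧
      (c.run M (Function.update env i t) τ 0 1 0 ≠ 0 ↔ τ 0 1 0 ≠ 0 ∨ B t)) :
    (Cmd.loop i c).run M env σ 0 0 = σ 0 0 ∧
      ((Cmd.loop i c).run M env σ 0 1 0 ≠ 0 ↔ σ 0 1 0 ≠ 0 ∨ ∃ t < M, B t) := by
  refine run_loop (fun t τ => τ 0 0 = σ 0 0 ∧ (τ 0 1 0 ≠ 0 ↔ σ 0 1 0 ≠ 0 ∨ ∃ s < t, B s))
    ⟨rfl, by simp⟩ ?_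
  rintro t ht τ ⟨hτ, hB⟩
  refine ⟨(h t ht τ hτ).1, ?_⟩
  rw [(h t ht τ hτ).2, hB, or_assoc]
  refine or_congr_right ⟨?_, ?_⟩
  · rintro (⟨s, hs, h⟩ | h)
    exacts [⟨s, by omega, h⟩, ⟨t, by omega, h⟩]
  · rintro ⟨s, hs, h⟩
    obtain h' | rfl : s < t ∨ s = t := by omega
    exacts [.inl ⟨s, h', h⟩, .inr h]

/-- Set the flag if the guess in the variables `1`, `2`, `3` is accepted. -/
def tryGuess : Cmd :=
  .seq (fill (.lit 2) (.ite (Expr.eq (.var 5) (.lit 1)) (.var 1) (.lit 0))) <|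
  .seq (iterate 2 Expr.extend) <| .seq (fill (.lit 3) Expr.clash) <|
  .seq (iterate 3 Expr.eliminate) <|
  .store (.lit 0) (.lit 1) (.lit 0)
    (Expr.or (.load (.lit 0) (.lit 1) (.lit 0)) Expr.accepts)

/-- Try all guesses. -/
def search : Cmd := .loop 1 (.loop 2 (.loop 3 tryGuess))

end Cmd

/-! ### Meaning of the expressions of the algorithm -/

namespace Expr

section

variable {n M : ℕ} {σ : ℕ → ℕ → ℕ → ℕ} {env : ℕ → ℕ} {R : ℕ → ℕ → Prop}

/-- Division by 3 is a search for `q` and `l < 3` with `g = 3 * q + l`; `g < M` keeps the quotient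
within the search range. -/
theorem eval_extend (hM : 3 * n + 3 ≤ M) (hn : env 0 = n) (hR : IsInput n R σ) {t x y g : ℕ}
    {X : ℕ → Prop} (hy : y < M) (hg : g < M) (ht : env 4 = t) (hx : env 5 = x) (hy' : env 6 = y)
    (hX : ∀ y < M, σ (2 * t + 2) 0 y ≠ 0 ↔ X y) (hσ : σ (2 * t + 2) 1 0 = g) :
    (x = 0 → (Expr.extend.eval M σ env ≠ 0 ↔ _root_.extend n R X (g % 3) y)) ∧
      (x ≠ 0 → Expr.extend.eval M σ env = g / 3) := by
  classical
  have hst : current.Stable M σ env (2 * t + 2) := by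
    intro env' h
    simp [current, h 4 (by omega), ht]
    omega
  rw [Expr.extend, eval_ite, holds_eq, eval_var, eval_lit, hx]
  constructor
  · intro hx0
    rw [if_pos hx0]
    change Holds _ _ _ _ ↔ _
    rw [← extend_congr hX (by omega) _ hy]
    have h10 := fun d => hst.update (show 10 ≤ 10 by omega) d
    have h11 := fun d l => (h10 d).update (show 10 ≤ 11 by omega) l
    have h12 := fun d l q => (h11 d l).update (show 10 ≤ 12 by omega) q
    have hu := fun d => (h10 d).holds_undetermined (by omega) (show 10 ≠ 19 by omega)
    have hc := fun d => (h10 d).holds_chosen (d := 10) (by omega) (by omega)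
      (show _ = n by simp [hn]) hR (by omega) (by omega) (by omega)
    have he := fun d l => holds_excludes (n := n) (M := M)
      (env := Function.update (Function.update env 10 d) 11 l)
      (d := 10) (l := 11) (x := 6) (by omega) (by omega)
      (show _ = n by simp [hn]) hR (by omega) (by omega) (by omega)
    simp only [holds_or, holds_and, holds_ex, holds_lt, holds_eq, holds_load, eval_load,
      eval_lit3, hu, hc, he, hst env (fun _ _ => rfl), fun d l q => h12 d l q _ (fun _ _ => rfl)]
    simp only [eval_var, eval_lit, Function.update_apply]
    simp only [OfNat.zero_ne_ofNat, if_true, if_false, Nat.reduceEqDiff, hn,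
      hσ, hy', _root_.extend]
    refine or_congr_right (and_congr ?_ ?_)
    · exact ⟨fun ⟨u, _, hu⟩ => ⟨u, hu⟩, fun ⟨u, hu⟩ => ⟨u, by omega, hu⟩⟩
    · constructor
      · rintro ⟨d, -, hd, l, -, hl, ⟨q, -, hq⟩, h⟩
        obtain rfl : l = g % 3 := by omega
        exact ⟨d, hd, h⟩
      · rintro ⟨d, hd, h⟩
        exact ⟨d, by have := hd.1; omega, hd, g % 3, by omega, by omega,
          ⟨g / 3, by omega, by omega⟩, h⟩
  · intro hx0
    rw [if_neg hx0, Expr.eval]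
    have h12 := fun q => hst.update (show 10 ≤ 12 by omega) q
    have h11 := fun q l => (h12 q).update (show 10 ≤ 11 by omega) l
    simp only [eval_ite, holds_and, holds_ex, holds_lt, holds_eq, eval_load, eval_lit3,
      fun q l => h11 q l _ (fun _ _ => rfl)]
    simp only [eval_var, eval_lit, Function.update_apply]
    simp only [if_true, if_false, Nat.reduceEqDiff, hσ]
    have hiff : ∀ q, (∃ l < M, l < 3 ∧ g = 3 * q + l) ↔ g / 3 = q := by
      intro q
      constructor
      · rintro ⟨l, -, hl, h⟩
        omega
      · rintro rfl
        exact ⟨g % 3, by omega, by omega, by omega⟩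
    -- The sum of all `q` that pass the test has the single term `g / 3`.
    simp only [hiff, Finset.sum_ite_eq, Finset.mem_range]
    rw [if_pos (by omega)]

theorem holds_clash (hM : 3 * n + 3 ≤ M) (hn : env 0 = n) (hR : IsInput n R σ) {X : ℕ → Prop}
    (h5 : env 5 < M) (h6 : env 6 < M) (hX : ∀ y < M, σ (2 * n + 2) 0 y ≠ 0 ↔ X y) :
    Expr.clash.Holds M σ env ↔ Clash n R (env 2) (env 3) X (env 5) (env 6) := by
  have hR' : ∀ u v, R u v → u < n ∧ v < n := fun u v h => ⟨((hR u v).1 h).1, ((hR u v).1 h).2.1⟩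
  have hf : ∀ x, env x < M → (σ (final.eval M σ env) 0 (env x) ≠ 0 ↔ X (env x)) := by
    intro x hx
    rw [← hX _ hx]
    simp [final, hn, two_mul]
  have hadj := fun u v => holds_adj (env := Function.update (Function.update env 10 u) 11 v)
    (u := 10) (v := 11) hR (show n ≤ M by omega) (by simp [hn]) (by omega)
  simp only [clash, out, holds_or, holds_and, holds_ex, holds_lt, holds_eq, holds_load,
    eval_lit3, hadj, holds_conflict, eval_lit, eval_var, hf 5 h5, hf 6 h6]
  simp only [Function.update_apply]
  simp only [if_true, if_false, Nat.reduceEqDiff, Clash, add_zero]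
  refine or_congr_right (or_congr_right ⟨?_, ?_⟩)
  · rintro ⟨u, -, v, -, huv, l, -, hl, m, -, hm, hlm, h⟩
    exact ⟨u, (hR' u v huv).1, v, (hR' u v huv).2, huv, l, hl, m, hm, hlm, h⟩
  · rintro ⟨u, hu, v, hv, huv, l, hl, m, hm, hlm, h⟩
    exact ⟨u, by omega, v, by omega, huv, l, by omega, hl, m, by omega, hm, hlm, h⟩

theorem holds_eliminate (hM : 3 * n + 3 ≤ M) {F : ℕ → ℕ → Prop} {k : ℕ} (hk : env 4 = k)
    (hkn : k < n) (h5 : env 5 < M) (h6 : env 6 < M)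
    (hF : ∀ x < M, ∀ y < M, σ (2 * k + 3) x y ≠ 0 ↔ F x y) :
    Expr.eliminate.Holds M σ env ↔ _root_.eliminate k F (env 5) (env 6) := by
  simp only [eliminate, holds_or, holds_all, holds_not, holds_lt, holds_load, eval_add,
    eval_lit3, eval_lit, eval_var]
  simp only [Function.update_apply]
  simp only [if_true, if_false, Nat.reduceEqDiff, hk, ← two_mul]
  rw [_root_.eliminate, hF _ h5 _ h6]
  refine or_congr_right ⟨fun h l hl => ?_, fun h l _ => ?_⟩
  · have := (h l (by omega)).resolve_left (by omega)
    rwa [hF _ (by omega) _ h5, hF _ (by omega) _ h6] at this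
  · by_cases hl : l < 3
    · rw [hF _ (by omega) _ h5, hF _ (by omega) _ h6]
      exact .inr (h l hl)
    · exact .inl hl

theorem holds_accepts (hM : 3 * n + 3 ≤ M) (hn : env 0 = n) {X : ℕ → Prop} {F : ℕ → ℕ → Prop}
    (hX : ∀ y < M, σ (2 * n + 2) 0 y ≠ 0 ↔ X y)
    (hF : ∀ x < M, ∀ y < M, σ (2 * n + 3) x y ≠ 0 ↔ F x y) :
    Expr.accepts.Holds M σ env ↔ env 2 < n ∧ env 3 < n ∧ (∀ v < n, ¬Undetermined X v) ∧
      ¬F (3 * n) (3 * n) := by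
  have hst : final.Stable M σ env (2 * n + 2) := by
    intro env' h
    simp [final, h 0 (by omega), hn]
    omega
  have hu := fun v => (hst.update (show 10 ≤ 10 by omega) v).holds_undetermined (u := 10)
    (by omega) (by omega)
  simp only [accepts, holds_and, holds_or, holds_all, holds_not, holds_lt, holds_load, eval_add,
    eval_lit3, eval_lit, eval_var, hu]
  simp only [Function.update_apply]
  simp only [OfNat.zero_ne_ofNat, if_true, if_false, hn, add_zero, ← two_mul]
  rw [hF _ (by omega) _ (by omega)]
  refine and_congr_right fun _ => and_congr_right fun _ => and_congr_left fun _ => ?_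
  constructor
  · intro h v hv
    rw [← undetermined_congr hX (by omega) hv]
    exact (h v (by omega)).resolve_left (by omega)
  · intro h v _
    by_cases hv : v < n
    · rw [undetermined_congr hX (by omega) hv]
      exact .inr (h v hv)
    · exact .inl hv

end

end Expr

end RAM

/-! ### Correctness of the search program -/

theorem extendGuess_iterate_snd_le (n : ℕ) (adj : ℕ → ℕ → Prop) (X : ℕ → Prop) (g i : ℕ) :
    ((extendGuess n adj)^[i] (X, g)).2 ≤ g := by
  induction i with
  | zero => exact le_rfl
  | succ i ih =>
    rw [Function.iterate_succ_apply']
    exact (Nat.div_le_self _ _).trans ih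

namespace RAM

namespace Cmd

variable {n M : ℕ} {σ : ℕ → ℕ → ℕ → ℕ} {env : ℕ → ℕ} {R : ℕ → ℕ → Prop}

open RAM.Expr in
-- Array `2 * t + 2` holds the greedy state after `t` steps and array `2 * t + 3` the clashes after
-- `t` eliminations. Row 0 of array 0 keeps the input, and its entry (1, 0) is the flag. Arrays 2
-- and 3 are refilled for each guess, so leftovers of earlier guesses do no harm.
theorem run_tryGuess (hM : 3 * n + 3 ≤ M) (hn : env 0 = n) (hR : IsInput n R σ)
    (hg : env 1 < M) : tryGuess.run M env σ 0 0 = σ 0 0 ∧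
      (tryGuess.run M env σ 0 1 0 ≠ 0 ↔ σ 0 1 0 ≠ 0 ∨ Accepts n R (env 1) (env 2) (env 3)) := by
  set p : ℕ → (ℕ → Prop) × ℕ := fun t => (extendGuess n R)^[t] (fun _ => False, env 1) with hp
  have hpM : ∀ t, (p t).2 < M := fun t =>
    (extendGuess_iterate_snd_le n R _ (env 1) t).trans_lt hg
  have hps : ∀ t, p (t + 1) = (_root_.extend n R (p t).1 ((p t).2 % 3), (p t).2 / 3) :=
    fun t => Function.iterate_succ_apply' _ _ _
  simp only [tryGuess, Cmd.run]
  set σ₁ := (fill (.lit 2) (.ite (Expr.eq (.var 5) (.lit 1)) (.var 1) (.lit 0))).run M env σ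
    with hσ₁
  -- Initially row 0 excludes nothing and row 1 is constantly the guess.
  have h₁ : (∀ a', a' ≠ 2 → σ₁ a' = σ a') ∧ ∀ x < M, ∀ y < M,
      σ₁ 2 x y = if x = 1 then env 1 else 0 :=
    run_fill (Q := fun x y v => v = if x = 1 then env 1 else 0) (fun x y τ => rfl)
      fun x hx y hy τ _ => by
        classical
        rw [eval_ite]
        simp
  clear_value σ₁
  set σ₂ := (iterate 2 Expr.extend).run M env σ₁ with hσ₂
  have h₂ : (∀ a', (∀ s, a' ≠ 2 * s + 2 + 2) → σ₂ a' = σ₁ a') ∧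
      ∀ t ≤ M, ∀ x < M, ∀ y < M, (x = 0 → (σ₂ (2 * t + 2) x y ≠ 0 ↔ (p t).1 y)) ∧
        (x = 1 → σ₂ (2 * t + 2) x y = (p t).2) := by
    refine run_iterate (P := fun t x y v => (x = 0 → (v ≠ 0 ↔ (p t).1 y)) ∧
      (x = 1 → v = (p t).2)) ?_ ?_
    · intro x hx y hy
      rw [h₁.2 x hx y hy]
      exact ⟨by rintro rfl; simp [hp], by rintro rfl; simp [hp]⟩
    · intro t ht τ hτ hP x hx y hy
      have hR' : IsInput n R τ := by
        intro u v
        rw [hR u v, hτ 0 (by omega), h₁.1 0 (by omega)]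
      obtain ⟨e1, e2⟩ := eval_extend (R := R) (σ := τ) (X := (p t).1)
        (env := Function.update (Function.update (Function.update env 4 t) 5 x) 6 y)
        (t := t) (x := x) (y := y) (g := (p t).2) hM (by simp [hn]) hR' hy (hpM t) (by simp)
        (by simp) (by simp) (fun y hy => (hP 0 (by omega) y hy).1 rfl)
        ((hP 1 (by omega) 0 (by omega)).2 rfl)
      rw [hps]
      exact ⟨e1, fun h => e2 (by omega)⟩
  clear_value σ₂
  set X := (p n).1 with hX
  have hX₂ : ∀ y < M, σ₂ (2 * n + 2) 0 y ≠ 0 ↔ X y := fun y hy =>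
    (h₂.2 n (by omega) 0 (by omega) y hy).1 rfl
  have hR₂ : σ₂ 0 = σ 0 := by rw [h₂.1 0 (by omega), h₁.1 0 (by omega)]
  set σ₃ := (fill (.lit 3) Expr.clash).run M env σ₂ with hσ₃
  have h₃ : (∀ a', a' ≠ 3 → σ₃ a' = σ₂ a') ∧ ∀ x < M, ∀ y < M,
      (σ₃ 3 x y ≠ 0 ↔ Clash n R (env 2) (env 3) X x y) := by
    refine run_fill (Q := fun x y v => v ≠ 0 ↔ Clash n R (env 2) (env 3) X x y)
      (fun x y τ => rfl) fun x hx y hy τ hτ => ?_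
    have hR' : IsInput n R τ := by
      intro u v
      rw [hR u v, hτ 0 (by omega), hR₂]
    have := holds_clash (R := R) (σ := τ) (X := X)
      (env := Function.update (Function.update env 5 x) 6 y) hM (by simp [hn]) hR'
      (by simpa using hx) (by simpa using hy) (by rwa [hτ _ (by omega)])
    simpa [Holds] using this
  clear_value σ₃
  set σ₄ := (iterate 3 Expr.eliminate).run M env σ₃ with hσ₄
  -- The loop runs on to `M`, but only the first `n` eliminations correspond to vertices; the claim
  -- is restricted to `t ≤ n` and only array `2 * n + 3` is consulted.
  have h₄ : (∀ a', (∀ s, a' ≠ 2 * s + 3 + 2) → σ₄ a' = σ₃ a') ∧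
      ∀ t ≤ M, ∀ x < M, ∀ y < M, t ≤ n →
        (σ₄ (2 * t + 3) x y ≠ 0 ↔ clashes n R (env 2) (env 3) X t x y) := by
    refine run_iterate (P := fun t x y v => t ≤ n →
      (v ≠ 0 ↔ clashes n R (env 2) (env 3) X t x y)) ?_ ?_
    · exact fun x hx y hy _ => h₃.2 x hx y hy
    · intro t ht τ hτ hP x hx y hy htn
      have := holds_eliminate (σ := τ) (F := clashes n R (env 2) (env 3) X t) (k := t)
        (env := Function.update (Function.update (Function.update env 4 t) 5 x) 6 y) hM
        (by simp) htn (by simpa using hx) (by simpa using hy)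
        (fun x hx y hy => hP x hx y hy (by omega))
      simpa [Holds, clashes] using this
  clear_value σ₄
  have hσ₄ : σ₄ 0 = σ 0 := by rw [h₄.1 0 (by omega), h₃.1 0 (by omega), hR₂]
  have hacc := holds_accepts (σ := σ₄) (env := env) (X := X)
    (F := clashes n R (env 2) (env 3) X n) hM hn
    (by rwa [h₄.1 _ (by omega), h₃.1 _ (by omega)])
    (fun x hx y hy => h₄.2 n (by omega) x hx y hy le_rfl)
  have hor := holds_or (M := M) (σ := σ₄) (env := env)
    (.load (.lit 0) (.lit 1) (.lit 0)) Expr.accepts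
  rw [hacc, holds_load, eval_lit, eval_lit, hσ₄] at hor
  constructor
  · funext y
    rw [write, if_neg (by simp), hσ₄]
  · rw [write, if_pos ⟨rfl, rfl, rfl, by simp; omega, by simp; omega⟩]
    exact hor

theorem run_search (hM : 3 * n + 3 ≤ M) (hn : env 0 = n) (hR : Expr.IsInput n R σ) :
    search.run M env σ 0 1 0 ≠ 0 ↔
      σ 0 1 0 ≠ 0 ∨ ∃ g < M, ∃ a < M, ∃ b < M, Accepts n R g a b := by
  refine (run_loop_flag (B := fun g => ∃ a < M, ∃ b < M, Accepts n R g a b)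
    fun g hg τ₁ h₁ => ?_).2
  rw [← h₁]
  refine run_loop_flag (B := fun a => ∃ b < M, Accepts n R g a b) fun a ha τ₂ h₂ => ?_
  rw [← h₂]
  refine run_loop_flag (B := fun b => Accepts n R g a b) fun b hb τ₃ h₃ => ?_
  rw [← h₃]
  have hR₃ : Expr.IsInput n R τ₃ := by
    intro u v
    rw [hR u v, h₃, h₂, h₁]
  simpa using run_tryGuess (R := R) (σ := τ₃)
    (env := Function.update (Function.update (Function.update env 1 g) 2 a) 3 b) hM
    (by simp [hn]) hR₃ (by simpa using hg)

end Cmd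

theorem input_mem_ne_zero_iff {n : ℕ} (G : SimpleGraph (Fin n)) {u v : ℕ} (hv : v < n) :
    (input G).mem (n * u + v) ≠ 0 ↔ natAdj G u v := by
  classical
  simp only [input, ne_eq, ite_eq_right_iff, one_ne_zero, imp_false, not_not]
  constructor
  · rintro ⟨i, j, h, hij⟩
    have h1 := congrArg (· / n) h
    have h2 := congrArg (· % n) h
    have hn : 0 < n := by omega
    simp only [mul_comm _ n, Nat.mul_add_div hn, Nat.div_eq_of_lt hv, Nat.div_eq_of_lt j.2,
      Nat.mul_add_mod, Nat.mod_eq_of_lt hv, Nat.mod_eq_of_lt j.2, add_zero] at h1 h2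
    subst h1 h2
    exact ⟨i.2, j.2, hij⟩
  · rintro ⟨hu, hv, h⟩
    exact ⟨⟨u, hu⟩, ⟨v, hv⟩, by rw [mul_comm], h⟩

theorem isInput_view {n M : ℕ} (G : SimpleGraph (Fin n)) (hM : n ^ 2 ≤ M) :
    Expr.IsInput n (natAdj G) (view M (input G).mem) := by
  intro u v
  have key : u < n → v < n → (view M (input G).mem 0 0 (n * u + v) ≠ 0 ↔ natAdj G u v) := by
    intro hu hv
    have : n * u + v < n ^ 2 := by nlinarith
    rw [view, if_pos ⟨by omega, by omega⟩, ← input_mem_ne_zero_iff G hv]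
    simp
  constructor
  · intro h
    obtain ⟨hu, hv, -⟩ := id h
    exact ⟨hu, hv, (key hu hv).2 h⟩
  · rintro ⟨hu, hv, h⟩
    exact (key hu hv).1 h

/-- Guarantees that the flag, whose cell lies beyond the adjacency matrix, starts at 0. -/
theorem input_mem_eq_zero {n k : ℕ} (G : SimpleGraph (Fin n)) (hk : n ^ 2 ≤ k) :
    (input G).mem k = 0 := by
  classical
  simp only [input, ite_eq_right_iff, one_ne_zero, imp_false]
  rintro ⟨i, j, rfl, -⟩
  have hi := i.2
  have hj := j.2
  nlinarith

end RAM

/-! ### Dense graphs and the running time -/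

theorem Accepts.hasIndependentCut {n g a b : ℕ} {G : SimpleGraph (Fin n)}
    (h : Accepts n (natAdj G) g a b) : HasIndependentCut G :=
  (hasIndependentCut_iff G).2 ⟨a, h.1, b, h.2.1, h.exists_isCutLabelling
    (fun _ ⟨_, _, h⟩ => h.ne rfl) fun _ _ ⟨hu, hv, h⟩ => ⟨hv, hu, h.symm⟩⟩

theorem HasIndependentCut.exists_accepts {n : ℕ} {G : SimpleGraph (Fin n)}
    (h : HasIndependentCut G) (hn : 0 < n)
    (hdeg : ∀ u < n, ∃ s : Finset ℕ, n ≤ 2 * s.card ∧ ∀ d ∈ s, d < n ∧ natAdj G d u) :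
    ∃ g < 4 * n ^ 2, ∃ a b, Accepts n (natAdj G) g a b := by
  obtain ⟨a, ha, b, hb, f, hf⟩ := (hasIndependentCut_iff G).1 h
  obtain ⟨g, hg, h⟩ := hf.exists_accepts hn hdeg ha hb
  exact ⟨g, hg, a, b, h⟩

theorem IsDense.two_le {n : ℕ} {G : SimpleGraph (Fin n)} {β : ℝ} (h : IsDense G β) : 2 ≤ n := by
  classical
  obtain ⟨hn, hβ, hδ⟩ := h
  by_contra hlt
  obtain rfl : n = 1 := by omega
  have h0 : G.minDegree < 1 := by simp
  have h1 : (G.minDegree : ℝ) < 1 / 2 := by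
    rw [Nat.lt_one_iff.1 h0]
    norm_num
  push_cast at hδ
  linarith

/-- Density enters the domination argument only here: β > 1/2 makes every degree at least n/2. -/
theorem IsDense.exists_neighbours {n : ℕ} {G : SimpleGraph (Fin n)} {β : ℝ} (h : IsDense G β)
    (u : ℕ) (hu : u < n) :
    ∃ s : Finset ℕ, n ≤ 2 * s.card ∧ ∀ d ∈ s, d < n ∧ natAdj G d u := by
  classical
  obtain ⟨hn, hβ, hδ⟩ := h
  refine ⟨(G.neighborFinset ⟨u, hu⟩).map Fin.valEmbedding, ?_, ?_⟩
  · rw [Finset.card_map, G.card_neighborFinset_eq_degree]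
    have h1 : (G.minDegree : ℝ) ≤ (G.degree ⟨u, hu⟩ : ℝ) := by
      exact_mod_cast G.minDegree_le_degree _
    have h2 : (n : ℝ) ≤ 2 * (G.degree ⟨u, hu⟩ : ℝ) := by
      have : (0 : ℝ) < n := by exact_mod_cast hn
      have h3 : β * n ≤ (G.degree ⟨u, hu⟩ : ℝ) := by
        -- The two minimum degrees may differ in their decidability instances.
        refine le_trans (le_trans hδ (le_of_eq ?_)) h1
        congr!
      nlinarith
    exact_mod_cast h2
  · intro d hd
    simp only [Finset.mem_map, SimpleGraph.mem_neighborFinset] at hd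
    obtain ⟨d, hd, rfl⟩ := hd
    exact ⟨d.2, d.2, hu, hd.symm⟩

/-- Independent Cut is decidable in polynomial time on graphs of minimum degree at least half of
their order: such a graph has a dominating set of logarithmic size, so all labellings of it by the
cut and the two sides can be tried, and each of them leaves an instance of 2-satisfiability. -/
theorem exists_decidesWithin_pow : ∃ (P : RAM.Prog) (c : ℕ), ∀ (n : ℕ) (G : SimpleGraph (Fin n))
    (β : ℝ), IsDense G β → RAM.DecidesWithin P G (HasIndependentCut G) ((n : ℝ) ^ c) := by
  classical
  let e : RAM.Expr := .ite (.load (.lit 0) (.lit 1) (.lit 0)) (.lit 1) (.lit 0)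
  obtain ⟨c, hc⟩ := RAM.exists_runs_program RAM.Cmd.search e
  refine ⟨RAM.program RAM.Cmd.search e, c, fun n G β hG => ?_⟩
  have hn := hG.two_le
  obtain ⟨s, t, hexec, ht, hs⟩ := hc n hn G
  refine ⟨s, t, hexec, by exact_mod_cast ht, ?_⟩
  -- The loop range has to contain all guesses below `4 * n ^ 2`; here `4 ≤ n ^ 2` because `2 ≤ n`.
  have h4 : 4 * n ^ 2 ≤ n ^ 8 := calc
    4 * n ^ 2 ≤ n ^ 2 * n ^ 2 := Nat.mul_le_mul_right _ (by nlinarith)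
    _ = n ^ 4 := by ring
    _ ≤ n ^ 8 := Nat.pow_le_pow_right (by omega) (by omega)
  have hM : 3 * n + 3 ≤ n ^ 8 := by nlinarith
  have hM2 : n ^ 2 ≤ n ^ 8 := by omega
  have hrun := RAM.Cmd.run_search (σ := RAM.view (n ^ 8) (RAM.input G).mem)
    (env := RAM.initEnv n) hM rfl (RAM.isInput_view G hM2)
  -- The flag entry has the address `n ^ 8`, past the `n ^ 2` cells of the matrix.
  have hflag : RAM.view (n ^ 8) (RAM.input G).mem 0 1 0 = 0 := by
    rw [RAM.view, if_pos ⟨by omega, by omega⟩]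
    exact RAM.input_mem_eq_zero G (by simpa using hM2)
  rw [hflag] at hrun
  have hiff : HasIndependentCut G ↔
      RAM.Cmd.search.run (n ^ 8) (RAM.initEnv n) (RAM.view (n ^ 8) (RAM.input G).mem) 0 1 0 ≠ 0 := by
    rw [hrun]
    constructor
    · intro h
      obtain ⟨g, hg, a, b, h⟩ := h.exists_accepts (by omega) hG.exists_neighbours
      have := h.1
      have := h.2.1
      exact .inr ⟨g, by omega, a, by omega, b, by omega, h⟩
    · rintro (h | ⟨g, -, a, -, b, -, h⟩)
      · exact absurd rfl h
      · exact h.hasIndependentCut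
  rw [hs, RAM.Expr.eval_ite, RAM.Expr.eval_lit, RAM.Expr.eval_lit]
  exact if_congr hiff.symm rfl rfl

theorem corollary6 :
    (∃ (P : RAM.Prog) (c : ℕ), ∀ (n : ℕ) (G : SimpleGraph (Fin n)) (β : ℝ), IsDense G β →
      RAM.DecidesWithin P G (HasIndependentCut G)
        ((2 : ℝ) ^ (1 / (2 * β - 1) ^ 2) * (n : ℝ) ^ c)) ∧
    IsFixedParameterTractable (fun {_} G => HasIndependentCut G) (fun {_} G β => IsDense G β) := by
  obtain ⟨P, c, h⟩ := exists_decidesWithin_pow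
  refine ⟨⟨P, c, fun n G β hG => ?_⟩, P, fun _ => 1, c, Computable.const 1, fun n G β hG => ?_⟩
  · obtain ⟨s, t, he, ht, hs⟩ := h n G β hG
    refine ⟨s, t, he, ht.trans (le_mul_of_one_le_left (by positivity) ?_), hs⟩
    -- The exponent is nonnegative, so the exponential factor only loosens the polynomial bound.
    exact Real.one_le_rpow one_le_two (by positivity)
  · simpa using h n G β hG
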